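/- Let $1\le p\le\infty$ and $\sigma>0$. For $1\le p<\infty$ let $X^p=X^p(\mathbb R_+)$ be the space of measurable functions $f:\mathbb R_+\to\mathbb C$ (identified when equal almost everywhere) with $\|f\|_{X^p}=\|f(x)x^{-1/p}\|_{L^p(\mathbb R_+)}<\infty$, and let $X^\infty$ be the space of measurable functions with $\|f\|_{X^\infty}=\sup_{x>0}|f(x)|<\infty$. Let $U(t)f(x)=f(e^tx)$, and let $\Theta$ be its infinitesimal generator in $X^p$: $\Theta f=g$ if $f,g\in X^p$ and $(U(t)f-f)/t\to g$ in $X^p$ as $t\to0$; on smooth functions in its domain $\Theta=x\frac{d}{dx}$. The Bernstein space $\mathbf B_\sigma^p(\Theta)$ is the set of all $f\in X^p$ that belong to the domain of $\Theta^k$ for all $k\in\mathbb N$ and satisfy $\|\Theta^kf\|_{X^p}\le\sigma^k\|f\|_{X^p}$ for all $k\in\mathbb N$. Put $\operatorname{sinc}(x)=\frac{\sin\pi x}{\pi x}$, $\operatorname{sinc}(0)=1$, and for $m\ge1$ let $A_{m,k}=(-1)^{k+1}\operatorname{sinc}^{(2m-1)}(\tfrac12-k)$ for $k\in\mathbb Z$,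 $B_{m,k}=(-1)^{k+1}\operatorname{sinc}^{(2m)}(-k)$ for $k\in\mathbb Z\setminus\{0\}$, and $B_{m,0}=(-1)^{m+1}\frac{\pi^{2m}}{2m+1}$. For $m\ge 1$ define $$\mathcal R^{(2m-1)}(\sigma)f(x)=\Big(\frac{\sigma}{\pi}\Big)^{2m-1}\sum_{k\in\mathbb Z}(-1)^{k+1}A_{m,k}\,f\big(e^{\frac{\pi}{\sigma}(k-\frac12)}x\big),\qquad \mathcal R^{(2m)}(\sigma)f(x)=\Big(\frac{\sigma}{\pi}\Big)^{2m}\sum_{k\in\mathbb Z}(-1)^{k+1}B_{m,k}\,f\big(e^{\frac{\pi k}{\sigma}}x\big),$$ as series converging in $X^p$. **Theorem.** For $f\in X^p$ the following conditions are equivalent: 1. $f\in\mathbf B_\sigma^p(\Theta)$; 2. for every integer $r\ge1$, $f$ is in the domain of $\Theta^r$ and $\Theta^rf=\mathcal R^{(r)}(\sigma)f$ in $X^p$; 3. $f$ is equal in $X^p$ (almost everywhere if $p<\infty$, everywhere if $p=\infty$) to a function $F\in C^\infty(\mathbb R_+)$ such that for every integer $r\ge1$ and every $x>0$ one has $\left(x\frac{d}{dx}\right)^rF(x)=\mathcal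 R^{(r)}(\sigma)F(x)$, where the series converges absolutely at every point of $\mathbb R_+$ and uniformly on $\mathbb R_+$. -/

import Mathlib

open Set Filter Topology MeasureTheory

noncomputable section

namespace MellinBernstein

open scoped ENNReal

/-- The norm of `X^p(ℝ₊)`: for `p < ∞` it is the `L^p(ℝ₊)`-norm of `x ↦ f x * x ^ (-1/p)`,
for `p = ∞` it is the supremum of `|f x|` over `x > 0` (a supremum, not an essential supremum).
Functions on `ℝ₊` are functions on `ℝ` of which only the values on `Ioi 0` are ever used. -/
def XNorm (p : ℝ≥0∞) (f : ℝ → ℂ) : ℝ≥0∞ :=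
  if p = ∞ then ⨆ x ∈ Ioi (0 : ℝ), ‖f x‖ₑ
  else eLpNorm (fun x : ℝ => f x * ((x ^ (-(1 / p.toReal)) : ℝ) : ℂ)) p
    (volume.restrict (Ioi (0 : ℝ)))

/-- Membership in `X^p(ℝ₊)`: `f` is Lebesgue measurable on `ℝ₊` and has finite norm. -/
def MemX (p : ℝ≥0∞) (f : ℝ → ℂ) : Prop :=
  AEStronglyMeasurable f (volume.restrict (Ioi (0 : ℝ))) ∧ XNorm p f < ∞

/-- Equality of two elements of `X^p(ℝ₊)`: almost everywhere for `p < ∞`, everywhere on `ℝ₊`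
for `p = ∞`. -/
def XEq (p : ℝ≥0∞) (f g : ℝ → ℂ) : Prop :=
  XNorm p (fun x => f x - g x) = 0

/-- The Mellin translation `U(t) f (x) = f (e^t x)`. -/
def mellinShift (t : ℝ) (f : ℝ → ℂ) : ℝ → ℂ :=
  fun x => f (Real.exp t * x)

/-- `f` is in the domain of the infinitesimal generator `Θ` of the group `U` in `X^p(ℝ₊)`, and
`Θ f = g`, that is, `(U(t) f - f) / t → g` in the norm of `X^p(ℝ₊)` as `t → 0`. -/
def IsTheta (p : ℝ≥0∞) (f g : ℝ → ℂ) : Prop :=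
  MemX p f ∧ MemX p g ∧
    Tendsto (fun t : ℝ => XNorm p (fun x => (mellinShift t f x - f x) / (t : ℂ) - g x))
      (𝓝[≠] 0) (𝓝 0)

/-- `f` is in the domain of the power `Θ^k` in `X^p(ℝ₊)`, and `Θ^k f = g`. -/
def IsThetaPow (p : ℝ≥0∞) : ℕ → (ℝ → ℂ) → (ℝ → ℂ) → Prop
  | 0, f, g => MemX p f ∧ MemX p g ∧ XEq p f g
  | k + 1, f, g => ∃ h : ℝ → ℂ, IsThetaPow p k f h ∧ IsTheta p h g

/-- The Bernstein space `B_σ^p(Θ)`: all `f` in `X^p(ℝ₊)` that are in the domain of every power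
of `Θ` and satisfy `‖Θ^k f‖ ≤ σ^k ‖f‖` for all `k`. -/
def MemBernstein (σ : ℝ) (p : ℝ≥0∞) (f : ℝ → ℂ) : Prop :=
  MemX p f ∧ ∀ k : ℕ, ∃ g : ℝ → ℂ,
    IsThetaPow p k f g ∧ XNorm p g ≤ ENNReal.ofReal (σ ^ k) * XNorm p f

/-- The classical differential operator `x d/dx`. -/
def xddx (f : ℝ → ℂ) : ℝ → ℂ :=
  fun x => (x : ℂ) * deriv f x

/-- The normalized cardinal sine `sin (π x) / (π x)`, equal to `1` at `0`. -/
def sincN (x : ℝ) : ℝ :=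
  Real.sinc (Real.pi * x)

/-- `A_{m,k} = (-1)^{k+1} sinc^{(2m-1)}(1/2 - k)`, for `m ≥ 1`. -/
def coeffA (m : ℕ) (k : ℤ) : ℝ :=
  (-1 : ℝ) ^ (k + 1) * iteratedDeriv (2 * m - 1) sincN (1 / 2 - (k : ℝ))

/-- `B_{m,k} = (-1)^{k+1} sinc^{(2m)}(-k)` for `k ≠ 0`, and `B_{m,0} = (-1)^{m+1} π^{2m}/(2m+1)`,
for `m ≥ 1`. -/
def coeffB (m : ℕ) (k : ℤ) : ℝ :=
  if k = 0 then (-1 : ℝ) ^ (m + 1) * (Real.pi ^ (2 * m) / (2 * (m : ℝ) + 1))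
  else (-1 : ℝ) ^ (k + 1) * iteratedDeriv (2 * m) sincN (-(k : ℝ))

/-- The `k`-th term of the series of order `2m - 1`. -/
def termOdd (m : ℕ) (σ : ℝ) (f : ℝ → ℂ) (k : ℤ) (x : ℝ) : ℂ :=
  (((σ / Real.pi) ^ (2 * m - 1) * ((-1 : ℝ) ^ (k + 1) * coeffA m k) : ℝ) : ℂ) *
    f (Real.exp (Real.pi / σ * ((k : ℝ) - 1 / 2)) * x)

/-- The `k`-th term of the series of order `2m`. -/
def termEven (m : ℕ) (σ : ℝ) (f : ℝ → ℂ) (k : ℤ) (x : ℝ) : ℂ :=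
  (((σ / Real.pi) ^ (2 * m) * ((-1 : ℝ) ^ (k + 1) * coeffB m k) : ℝ) : ℂ) *
    f (Real.exp (Real.pi * (k : ℝ) / σ) * x)

/-- The `k`-th term of the series `R^{(r)}(σ) f (x)`, for `r ≥ 1`: `r = 2m - 1` or `r = 2m`. -/
def rieszTerm (r : ℕ) (σ : ℝ) (f : ℝ → ℂ) (k : ℤ) (x : ℝ) : ℂ :=
  if Odd r then termOdd ((r + 1) / 2) σ f k x else termEven (r / 2) σ f k x

/-- `R^{(r)}(σ) f = g` in `X^p(ℝ₊)`: the series over `k ∈ ℤ` that defines `R^{(r)}(σ) f`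
converges in the norm of `X^p(ℝ₊)` and has the sum `g`. -/
def IsRieszBoas (p : ℝ≥0∞) (r : ℕ) (σ : ℝ) (f g : ℝ → ℂ) : Prop :=
  MemX p g ∧
    Tendsto (fun s : Finset ℤ => XNorm p (fun x => (∑ k ∈ s, rieszTerm r σ f k x) - g x))
      atTop (𝓝 0)

end MellinBernstein

end

/-! The substitution `x = e^u` turns `X^p(ℝ₊)` into `L^p(ℝ)` (with the true supremum for `p = ∞`),
Mellin translations into translations and `Θ` into `d/du`. A function in the domain of every `Θ^k`
has a smooth representative `F`, and the theorem becomes one about bounded functions with `‖F^(k)‖ ≤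
C σ^k`.

From Bernstein to Riesz-Boas, scaled to type `π`: for `e^{2πiξx}` with `|ξ| ≤ 1/2` the formula at
the origin is the Fourier series of `(2πiξ)^r`, twisted for odd `r` so that the periodic extension
is continuous (`summable_nodeCoeff_and_hasSum`). The coefficients are then absolutely summable, and
Fourier inversion gives the formula for integrable functions of type `π`
(`hasSum_nodeCoeff_of_integrable`). A bounded `H` is replaced by `H((1-b)x) s(bx)` with an
integrable `s`, which keeps the total type `π`, and then `b → 0` (`hasSum_nodeCoeff_of_bounded`).
Summable coefficients and translation invariance of the norm give convergence in norm, absolutely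
and uniformly.

For the converses the formula of order one suffices. Its coefficients satisfy `∑ |c_k| = σ`
(`tsum_abs_rbCoeff_one`), so `‖F'‖ ≤ σ ‖F‖`. Differentiated term by term, the formula passes to
`F'`, and induction gives all Bernstein inequalities (`bernsteinRep_of_hasSum_rb_one`). This needs
`F` bounded, which follows from the norms of `F` and `F'` in condition 2 and from uniform
convergence in condition 3. -/

noncomputable section

namespace MellinBernstein

/-! ### Derivatives of `sinc` as Fourier coefficients. -/

section

open scoped ENNReal FourierTransform Real

/-- The node `k - 1/2` (odd order) or `k` (even order) of the normalized Riesz-Boas formula. -/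
def node (r : ℕ) (k : ℤ) : ℝ := if Odd r then (k : ℝ) - 1 / 2 else k

/-- The coefficient of the normalized Riesz-Boas formula. -/
def nodeCoeff (r : ℕ) (k : ℤ) : ℝ := iteratedDeriv r sincN (-node r k)

lemma norm_fourier_apply {T : ℝ} (n : ℤ) (x : AddCircle T) : ‖fourier n x‖ = 1 := by
  rw [fourier_apply, Circle.norm_coe]

/-- Fourier coefficients of a twice continuously differentiable function whose values at the two
ends of the interval agree are absolutely summable. -/
lemma summable_fourierCoeffOn {a b : ℝ} (hab : a < b) {f f' f'' : ℝ → ℂ}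
    (hf : ∀ x, HasDerivAt f (f' x) x) (hf' : ∀ x, HasDerivAt f' (f'' x) x)
    (hc : Continuous f'') (h : f a = f b) : Summable (fourierCoeffOn hab f) := by
  have hcf' : Continuous f' := continuous_iff_continuousAt.2 fun x => (hf' x).continuousAt
  -- Two integrations by parts: the first boundary term vanishes because `f a = f b`, the second
  -- already carries the factor `1 / n ^ 2`.
  have key : ∀ n : ℤ, n ≠ 0 → fourierCoeffOn hab f n = (b - a) / (-2 * π * Complex.I * n) ^ 2 *
      ((b - a) * fourierCoeffOn hab f'' n
        - fourier (-n) (a : AddCircle (b - a)) * (f' b - f' a)) := by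
    intro n hn
    have hn' : (n : ℂ) ≠ 0 := by exact_mod_cast hn
    have hpi : (π : ℂ) ≠ 0 := by exact_mod_cast Real.pi_ne_zero
    rw [fourierCoeffOn_of_hasDerivAt hab hn (fun x _ => hf x) (hcf'.intervalIntegrable _ _),
      fourierCoeffOn_of_hasDerivAt hab hn (fun x _ => hf' x) (hc.intervalIntegrable _ _), h]
    field_simp
    ring
  obtain ⟨M, hM⟩ : ∃ M, ∀ n, ‖fourierCoeffOn hab f'' n‖ ≤ M := by
    refine ⟨(1 / (b - a)) * |∫ x in a..b, ‖f'' x‖|, fun n => ?_⟩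
    rw [fourierCoeffOn_eq_integral, norm_smul, Real.norm_of_nonneg (by
      have := sub_pos.2 hab; positivity)]
    have : 0 ≤ 1 / (b - a) := by have := sub_pos.2 hab; positivity
    gcongr
    refine (intervalIntegral.norm_integral_le_abs_integral_norm).trans (le_of_eq ?_)
    congr 2
    ext x
    rw [norm_smul, norm_fourier_apply, one_mul]
  have hs : Summable fun n : ℤ => (‖((b - a : ℝ) : ℂ) / (-2 * π * Complex.I) ^ 2‖ *
      ((b - a) * M + ‖f' b - f' a‖)) * (1 / (n : ℝ) ^ 2) :=
    (Real.summable_one_div_int_pow.2 one_lt_two).mul_left _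
  refine Summable.of_norm_bounded_eventually hs ?_
  have h0 : ({0} : Set ℤ).Finite := Set.finite_singleton 0
  filter_upwards [h0.compl_mem_cofinite] with n hn
  have hn : n ≠ 0 := by simpa using hn
  rw [key n hn, norm_mul]
  have e1 : ‖((b : ℂ) - a) / (-2 * π * Complex.I * n) ^ 2‖ =
      ‖((b - a : ℝ) : ℂ) / (-2 * π * Complex.I) ^ 2‖ * (1 / (n : ℝ) ^ 2) := by
    rw [mul_pow _ (n : ℂ), ← div_div, norm_div _ ((n : ℂ) ^ 2), norm_pow (n : ℂ)]
    simp [div_eq_mul_inv]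
  rw [e1]
  have e2 : ‖((b : ℂ) - a) * fourierCoeffOn hab f'' n
        - fourier (-n) (a : AddCircle (b - a)) * (f' b - f' a)‖ ≤ (b - a) * M + ‖f' b - f' a‖ := by
    refine (norm_sub_le _ _).trans ?_
    rw [norm_mul, norm_mul]
    have : ‖((b : ℂ) - a)‖ = b - a := by
      rw [← Complex.ofReal_sub, Complex.norm_real, Real.norm_of_nonneg (sub_pos.2 hab).le]
    rw [this]
    rw [norm_fourier_apply, one_mul]
    have := sub_pos.2 hab
    gcongr
    exact hM n
  calc _ ≤ ‖((b - a : ℝ) : ℂ) / (-2 * π * Complex.I) ^ 2‖ * (1 / (n : ℝ) ^ 2) *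
        ((b - a) * M + ‖f' b - f' a‖) := by gcongr
    _ = _ := by ring

/-- Pointwise convergence of the Fourier series on a closed interval. -/
lemma hasSum_fourierCoeffOn {a b : ℝ} (hab : a < b) {f : ℝ → ℂ} (hf : Continuous f)
    (h : f a = f b) (hs : Summable (fourierCoeffOn hab f)) {x : ℝ} (hx : x ∈ Icc a b) :
    HasSum (fun n : ℤ => fourierCoeffOn hab f n * fourier n (x : AddCircle (b - a))) (f x) := by
  have := Fact.mk (sub_pos.2 hab)
  have hb : a + (b - a) = b := by ring
  let B : C(AddCircle (b - a), ℂ) :=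
    ⟨AddCircle.liftIoc (b - a) a f, AddCircle.liftIoc_continuous (by rw [hb, h]) hf.continuousOn⟩
  have main : ∀ y ∈ Ioc a b, HasSum (fun n : ℤ => fourierCoeffOn hab f n *
      fourier n (y : AddCircle (b - a))) (f y) := by
    intro y hy
    have := has_pointwise_sum_fourier_series_of_summable (f := B) hs (y : AddCircle (b - a))
    have e : B (y : AddCircle (b - a)) = f y :=
      AddCircle.liftIoc_coe_apply (by rwa [hb])
    rw [e] at this
    exact this
  -- The lift to the circle lives on `Ioc`; the left endpoint is the same point of the circle as
  -- `b`, where `f` takes the same value.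
  rcases eq_or_lt_of_le hx.1 with rfl | hlt
  · have e : ((a : ℝ) : AddCircle (b - a)) = ((b : ℝ) : AddCircle (b - a)) := by
      have := AddCircle.coe_add_period (b - a) a
      rw [hb] at this
      exact this.symm
    rw [h, e]
    exact main b ⟨hab, le_rfl⟩
  · exact main x ⟨hlt, hx.2⟩

/-- `sinc` is the Fourier transform of the indicator function of `[-1/2, 1/2]`. -/
lemma fourier_indicator_eq_sincN (x : ℝ) :
    𝓕 (indicator (Ioc (-(1 / 2) : ℝ) (1 / 2)) (fun _ => (1 : ℂ))) x = (sincN x : ℂ) := by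
  rw [Real.fourier_real_eq_integral_exp_smul]
  have : (fun v : ℝ => Complex.exp (↑(-2 * π * v * x) * Complex.I) •
      indicator (Ioc (-(1 / 2) : ℝ) (1 / 2)) (fun _ => (1 : ℂ)) v) =
      indicator (Ioc (-(1 / 2) : ℝ) (1 / 2))
        (fun v : ℝ => Complex.exp ((-2 * π * x * Complex.I) * v)) := by
    ext v
    by_cases hv : v ∈ Ioc (-(1 / 2) : ℝ) (1 / 2)
    · rw [indicator_of_mem hv, indicator_of_mem hv, smul_eq_mul, mul_one]
      congr 1; push_cast; ring
    · rw [indicator_of_notMem hv, indicator_of_notMem hv, smul_zero]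
  rw [this, integral_indicator measurableSet_Ioc, ← intervalIntegral.integral_of_le (by norm_num)]
  rcases eq_or_ne x 0 with rfl | hx
  · simp [sincN]; norm_num
  · have hpi : (π : ℂ) ≠ 0 := by exact_mod_cast Real.pi_ne_zero
    have hx' : (x : ℂ) ≠ 0 := by exact_mod_cast hx
    have hne : (-2 * π * x * Complex.I) ≠ 0 := by simp [hpi, hx']
    rw [integral_exp_mul_complex hne, sincN, Real.sinc_of_ne_zero (mul_ne_zero Real.pi_ne_zero hx)]
    push_cast
    rw [Complex.sin]
    have e1 : -2 * (π : ℂ) * x * Complex.I * (1 / 2) = -(π * x) * Complex.I := by ring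
    have e2 : -2 * (π : ℂ) * x * Complex.I * -(1 / 2) = (π * x) * Complex.I := by ring
    rw [e1, e2]
    field_simp
    rw [Complex.I_sq]
    ring

/-- Iterated derivatives of a real function whose complexification is smooth. -/
lemma iteratedDeriv_ofReal_comp {g : ℝ → ℝ} (hg : ContDiff ℝ (⊤ : ℕ∞) g) (n : ℕ) (x : ℝ) :
    ((iteratedDeriv n g x : ℝ) : ℂ) = iteratedDeriv n (fun y => (g y : ℂ)) x := by
  induction n generalizing x with
  | zero => simp
  | succ n ih =>
    rw [iteratedDeriv_succ, iteratedDeriv_succ]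
    have hd : DifferentiableAt ℝ (iteratedDeriv n g) x :=
      (hg.differentiable_iteratedDeriv n (by exact_mod_cast WithTop.coe_lt_top n)) x
    have := hd.hasDerivAt.ofReal_comp.deriv
    rw [← this]
    congr 1
    ext y
    exact ih y

lemma integrable_pow_smul_indicator (n : ℕ) :
    Integrable (fun x : ℝ => x ^ n • indicator (Ioc (-(1 / 2) : ℝ) (1 / 2)) (fun _ => (1 : ℂ)) x) := by
  have : (fun x : ℝ => x ^ n • indicator (Ioc (-(1 / 2) : ℝ) (1 / 2)) (fun _ => (1 : ℂ)) x) =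
      indicator (Ioc (-(1 / 2) : ℝ) (1 / 2)) (fun x => ((x ^ n : ℝ) : ℂ)) := by
    ext v
    by_cases hv : v ∈ Ioc (-(1 / 2) : ℝ) (1 / 2)
    · rw [indicator_of_mem hv, indicator_of_mem hv]; simp
    · rw [indicator_of_notMem hv, indicator_of_notMem hv, smul_zero]
  rw [this, integrable_indicator_iff measurableSet_Ioc]
  exact (Continuous.integrableOn_Icc (by fun_prop)).mono_set Ioc_subset_Icc_self

lemma contDiff_sincN : ContDiff ℝ (⊤ : ℕ∞) sincN := by
  have h : ContDiff ℝ (⊤ : ℕ∞) (𝓕 (indicator (Ioc (-(1 / 2) : ℝ) (1 / 2)) (fun _ => (1 : ℂ)))) := by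
    refine Real.contDiff_fourier (N := ⊤) fun n _ => ?_
    refine (integrable_pow_smul_indicator n).norm.congr (ae_of_all _ fun x => ?_)
    simp
  have e : sincN = fun x => Complex.reCLM
      (𝓕 (indicator (Ioc (-(1 / 2) : ℝ) (1 / 2)) (fun _ => (1 : ℂ))) x) := by
    ext x
    rw [fourier_indicator_eq_sincN]
    simp
  rw [e]
  exact Complex.reCLM.contDiff.comp h

lemma iteratedDeriv_sincN (n : ℕ) (x : ℝ) :
    ((iteratedDeriv n sincN x : ℝ) : ℂ) = ∫ v in (-(1 / 2) : ℝ)..(1 / 2),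
      (2 * π * Complex.I * v) ^ n * Complex.exp (2 * π * Complex.I * v * x) := by
  have e : (fun y => (sincN y : ℂ)) =
      𝓕 (indicator (Ioc (-(1 / 2) : ℝ) (1 / 2)) (fun _ => (1 : ℂ))) := by
    ext y; rw [fourier_indicator_eq_sincN]
  rw [iteratedDeriv_ofReal_comp contDiff_sincN, e,
    Real.iteratedDeriv_fourier (N := ⊤) (fun n _ => integrable_pow_smul_indicator n) le_top,
    Real.fourier_real_eq_integral_exp_smul]
  have : (fun v : ℝ => Complex.exp (↑(-2 * π * v * x) * Complex.I) •
      (-2 * π * Complex.I * v) ^ n • indicator (Ioc (-(1 / 2) : ℝ) (1 / 2)) (fun _ => (1 : ℂ)) v) =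
      indicator (Ioc (-(1 / 2) : ℝ) (1 / 2))
        (fun v : ℝ => (2 * π * Complex.I * (-v : ℝ)) ^ n *
          Complex.exp (2 * π * Complex.I * (-v : ℝ) * x)) := by
    ext v
    by_cases hv : v ∈ Ioc (-(1 / 2) : ℝ) (1 / 2)
    · rw [indicator_of_mem hv, indicator_of_mem hv, smul_eq_mul, smul_eq_mul, mul_one, mul_comm]
      push_cast
      ring_nf
    · rw [indicator_of_notMem hv, indicator_of_notMem hv, smul_zero, smul_zero]
  rw [this, integral_indicator measurableSet_Ioc, ← intervalIntegral.integral_of_le (by norm_num),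
    intervalIntegral.integral_comp_neg (fun v : ℝ => (2 * π * Complex.I * v) ^ n *
          Complex.exp (2 * π * Complex.I * v * x)), neg_neg]

/-- The fractional offset of the nodes. -/
lemma node_eq_sub (r : ℕ) : ∃ δ : ℝ, (∀ k, node r k = k - δ) ∧
    (-1 : ℂ) ^ r * Complex.exp (-(π * Complex.I * δ)) = Complex.exp (π * Complex.I * δ) := by
  -- The second identity makes `(2πiv)^r e^{2πivδ}` agree at `v = ±1/2`: the offset `1/2`
  -- compensates the sign change of an odd power.
  by_cases hr : Odd r
  · refine ⟨1 / 2, fun k => by simp [node, hr], ?_⟩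
    have e : π * Complex.I * ((1 / 2 : ℝ) : ℂ) = π / 2 * Complex.I := by push_cast; ring
    rw [e, hr.neg_one_pow, Complex.exp_neg, Complex.exp_pi_div_two_mul_I]
    simp
  · refine ⟨0, fun k => by simp [node, hr], ?_⟩
    rw [(Nat.not_odd_iff_even.1 hr).neg_one_pow]
    simp

lemma neg_half_lt_half : (-(1 / 2) : ℝ) < 1 / 2 := by norm_num

/-- Both sides are the same integral over `[-1/2, 1/2]`, since `-node r k = δ - k`. -/
lemma fourierCoeffOn_eq_nodeCoeff {r : ℕ} {δ : ℝ} (hδ : ∀ k, node r k = k - δ) (k : ℤ) :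
    fourierCoeffOn neg_half_lt_half (fun v : ℝ => (2 * π * Complex.I * v) ^ r *
      Complex.exp (2 * π * Complex.I * v * δ)) k = nodeCoeff r k := by
  rw [fourierCoeffOn_eq_integral, nodeCoeff, iteratedDeriv_sincN]
  have : (1 / (1 / 2 - -(1 / 2)) : ℝ) = 1 := by norm_num
  rw [this, one_smul]
  congr 1
  ext v
  rw [fourier_coe_apply, hδ, smul_eq_mul, mul_left_comm, ← Complex.exp_add]
  congr 2
  push_cast
  ring

/-- The Riesz-Boas formula for exponentials. It is the Fourier series of the twisted power `ψ`, with
the twist divided out afterwards; equal values of `ψ` at the two ends make the coefficients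
summable. -/
lemma summable_nodeCoeff_and_hasSum (r : ℕ) : Summable (fun k => |nodeCoeff r k|) ∧
    ∀ ξ ∈ Icc (-(1 / 2) : ℝ) (1 / 2), HasSum (fun k : ℤ => (nodeCoeff r k : ℂ) *
      Complex.exp (2 * π * Complex.I * ξ * node r k)) ((2 * π * Complex.I * ξ) ^ r) := by
  obtain ⟨δ, hδ, hδ'⟩ := node_eq_sub r
  set ψ : ℝ → ℂ := fun v => (2 * π * Complex.I * v) ^ r *
    Complex.exp (2 * π * Complex.I * v * δ) with hψ
  have hcd : ContDiff ℝ 2 ψ := by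
    have : ContDiff ℝ 2 (fun v : ℝ => (v : ℂ)) := Complex.ofRealCLM.contDiff
    rw [hψ]
    fun_prop
  have hcd' : ContDiff ℝ 1 (deriv ψ) := hcd.deriv'
  have hends : ψ (-(1 / 2)) = ψ (1 / 2) := by
    simp only [hψ]
    have e1 : (2 * π * Complex.I * ((-(1 / 2) : ℝ) : ℂ)) = -1 * (2 * π * Complex.I * ((1 / 2 : ℝ) : ℂ)) := by
      push_cast; ring
    have e2 : Complex.exp (2 * π * Complex.I * ((-(1 / 2) : ℝ) : ℂ) * δ) =
        Complex.exp (-(π * Complex.I * δ)) := by congr 1; push_cast; ring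
    have e3 : Complex.exp (2 * π * Complex.I * ((1 / 2 : ℝ) : ℂ) * δ) =
        Complex.exp (π * Complex.I * δ) := by congr 1; push_cast; ring
    rw [e2, e3, e1, mul_pow, ← hδ']
    ring
  have hs : Summable (fourierCoeffOn neg_half_lt_half ψ) :=
    summable_fourierCoeffOn _ (fun x => (hcd.differentiable (by norm_num) x).hasDerivAt)
      (fun x => (hcd'.differentiable (by norm_num) x).hasDerivAt)
      (hcd'.continuous_deriv le_rfl) hends
  refine ⟨?_, fun ξ hξ => ?_⟩
  · refine hs.norm.congr fun k => ?_
    rw [fourierCoeffOn_eq_nodeCoeff hδ, Complex.norm_real, Real.norm_eq_abs]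
  · have := (hasSum_fourierCoeffOn neg_half_lt_half hcd.continuous hends hs hξ).mul_right
      (Complex.exp (-(2 * π * Complex.I * ξ * δ)))
    convert! this using 1
    · ext k
      rw [fourierCoeffOn_eq_nodeCoeff hδ, fourier_coe_apply, mul_assoc (nodeCoeff r k : ℂ),
        ← Complex.exp_add, hδ]
      congr 2
      push_cast
      ring
    · simp only [hψ]
      rw [mul_assoc ((2 * π * Complex.I * ξ) ^ r), ← Complex.exp_add]
      simp

lemma summable_nodeCoeff (r : ℕ) : Summable (fun k => |nodeCoeff r k|) :=
  (summable_nodeCoeff_and_hasSum r).1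

lemma hasSum_nodeCoeff_exp (r : ℕ) {ξ : ℝ} (hξ : ξ ∈ Icc (-(1 / 2) : ℝ) (1 / 2)) :
    HasSum (fun k : ℤ => (nodeCoeff r k : ℂ) *
      Complex.exp (2 * π * Complex.I * ξ * node r k)) ((2 * π * Complex.I * ξ) ^ r) :=
  (summable_nodeCoeff_and_hasSum r).2 ξ hξ

lemma half_sub_intCast_ne_zero (k : ℤ) : (1 / 2 - k : ℝ) ≠ 0 := by
  intro h
  have : (1 : ℝ) = 2 * k := by linarith
  have : (1 : ℤ) = 2 * k := by exact_mod_cast this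
  omega

/-- At a half-integer the cosine term of `sinc'` vanishes and the sine is `(-1) ^ k`, so the signs
alternate strictly. -/
lemma nodeCoeff_one (k : ℤ) :
    nodeCoeff 1 k = -(-1 : ℝ) ^ k * (1 / (π * (1 / 2 - k) ^ 2)) := by
  have hk := half_sub_intCast_ne_zero k
  have hn : -node 1 k = 1 / 2 - k := by simp [node]
  rw [nodeCoeff, iteratedDeriv_one, hn]
  have hev : sincN =ᶠ[𝓝 (1 / 2 - k : ℝ)] fun x => Real.sin (π * x) / (π * x) := by
    filter_upwards [isOpen_ne.mem_nhds hk] with x hx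
    exact Real.sinc_of_ne_zero (mul_ne_zero Real.pi_ne_zero hx)
  have hid : HasDerivAt (fun x : ℝ => π * x) π (1 / 2 - k : ℝ) := by
    simpa using (hasDerivAt_id (1 / 2 - k : ℝ)).const_mul π
  have hd := hid.sin.div hid (mul_ne_zero Real.pi_ne_zero hk)
  have hcos : Real.cos (π * (1 / 2 - k)) = 0 := by
    have : π * (1 / 2 - k) = π / 2 - k * π := by ring
    rw [this, Real.cos_pi_div_two_sub, Real.sin_int_mul_pi]
  have hsin : Real.sin (π * (1 / 2 - k)) = (-1) ^ k := by
    have : π * (1 / 2 - k) = π / 2 - k * π := by ring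
    rw [this, Real.sin_pi_div_two_sub, Real.cos_int_mul_pi]
  rw [hev.deriv_eq]
  refine (HasDerivAt.deriv hd).trans ?_
  rw [hcos, hsin]
  have := Real.pi_ne_zero
  field_simp
  ring

lemma abs_nodeCoeff_one (k : ℤ) : |nodeCoeff 1 k| = -(-1 : ℝ) ^ k * nodeCoeff 1 k := by
  have hpos : 0 ≤ 1 / (π * (1 / 2 - k : ℝ) ^ 2) := by have := Real.pi_pos; positivity
  have h1 : |-(-1 : ℝ) ^ k| = 1 := by rw [abs_neg, abs_neg_one_zpow]
  have h2 : (-1 : ℝ) ^ k * (-1 : ℝ) ^ k = 1 := by rw [← mul_zpow]; simp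
  rw [nodeCoeff_one, abs_mul, h1, abs_of_nonneg hpos]
  linear_combination (-1 / (π * (1 / 2 - k : ℝ) ^ 2)) * h2

/-- At the extreme frequency `ξ = 1/2` the phases `e^{πi(k-1/2)}` undo the alternating signs up to a
common factor, so the exponential series becomes the series of absolute values. This is the sharp
constant in Bernstein's inequality. -/
lemma tsum_abs_nodeCoeff_one : ∑' k, |nodeCoeff 1 k| = π := by
  have h := hasSum_nodeCoeff_exp 1 (ξ := 1 / 2) ⟨by norm_num, le_rfl⟩
  have h2 := h.mul_left (-Complex.I)
  have h3 : HasSum (fun k => ((|nodeCoeff 1 k| : ℝ) : ℂ)) (π : ℝ) := by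
    convert! h2 using 1
    · ext k
      have e : 2 * π * Complex.I * ((1 / 2 : ℝ) : ℂ) * (node 1 k : ℝ) =
          k * (π * Complex.I) - π / 2 * Complex.I := by
        simp [node]; ring
      rw [abs_nodeCoeff_one, e, Complex.exp_sub, Complex.exp_int_mul, Complex.exp_pi_mul_I,
        Complex.exp_pi_div_two_mul_I]
      push_cast
      field_simp
    · push_cast
      linear_combination (π : ℂ) * Complex.I_sq
  exact (Complex.hasSum_ofReal.1 h3).tsum_eq

end

/-! ### An integrable multiplier, and the formula for integrable functions of type `π`. -/

section

open scoped ENNReal FourierTransform Real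

/-- Leibniz estimate: geometric `L¹` bounds for mixed products of derivatives give geometric `L¹`
bounds for the derivatives of the product. -/
lemma integral_norm_iteratedDeriv_mul_le {u v : ℝ → ℂ} (hu : ContDiff ℝ (⊤ : ℕ∞) u)
    (hv : ContDiff ℝ (⊤ : ℕ∞) v) {E α β : ℝ}
    (hint : ∀ i j, Integrable (fun x => iteratedDeriv i u x * iteratedDeriv j v x))
    (hle : ∀ i j, ∫ x, ‖iteratedDeriv i u x * iteratedDeriv j v x‖ ≤ E * α ^ i * β ^ j) (k : ℕ) :
    Integrable (iteratedDeriv k (u * v)) ∧ ∫ x, ‖iteratedDeriv k (u * v) x‖ ≤ E * (α + β) ^ k := by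
  have e : iteratedDeriv k (u * v) = fun x => ∑ i ∈ Finset.range (k + 1),
      (k.choose i : ℂ) * (iteratedDeriv i u x * iteratedDeriv (k - i) v x) := by
    ext x
    rw [iteratedDeriv_mul (hu.contDiffAt.of_le (by exact_mod_cast le_top))
      (hv.contDiffAt.of_le (by exact_mod_cast le_top))]
    simp only [mul_assoc]
  have hI : ∀ i ∈ Finset.range (k + 1), Integrable (fun x =>
      (k.choose i : ℂ) * (iteratedDeriv i u x * iteratedDeriv (k - i) v x)) :=
    fun i _ => (hint i (k - i)).const_mul _
  have hI' : Integrable (iteratedDeriv k (u * v)) := by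
    rw [e]
    exact integrable_finsetSum _ hI
  refine ⟨hI', ?_⟩
  calc ∫ x, ‖iteratedDeriv k (u * v) x‖
      ≤ ∫ x, ∑ i ∈ Finset.range (k + 1),
        (k.choose i : ℝ) * ‖iteratedDeriv i u x * iteratedDeriv (k - i) v x‖ := by
        refine integral_mono hI'.norm
          (integrable_finsetSum _ fun i _ => (hint i (k - i)).norm.const_mul _) fun x => ?_
        simp only [e]
        refine (norm_sum_le _ _).trans (Finset.sum_le_sum fun i _ => ?_)
        rw [norm_mul (k.choose i : ℂ), Complex.norm_natCast]
    _ = ∑ i ∈ Finset.range (k + 1), (k.choose i : ℝ) *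
        ∫ x, ‖iteratedDeriv i u x * iteratedDeriv (k - i) v x‖ := by
        rw [integral_finsetSum _ fun i _ => (hint i (k - i)).norm.const_mul _]
        simp only [integral_const_mul]
    _ ≤ ∑ i ∈ Finset.range (k + 1), (k.choose i : ℝ) * (E * α ^ i * β ^ (k - i)) := by
        gcongr with i _
        exact hle i (k - i)
    _ = E * (α + β) ^ k := by
        rw [add_pow, Finset.mul_sum]
        exact Finset.sum_congr rfl fun i _ => by ring

/-- The derivatives of the Fourier transform of a test function supported in `[-1/4, 1/4]` have
geometrically bounded `L²` norms. -/
lemma integral_sq_iteratedDeriv_fourier_le {φ : ℝ → ℂ} (hφ : ContDiff ℝ (⊤ : ℕ∞) φ)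
    (hs : ∀ x, 1 / 4 < |x| → φ x = 0) (j : ℕ) :
    Integrable (fun x => ‖iteratedDeriv j (𝓕 φ) x‖ ^ 2) ∧
      ∫ x, ‖iteratedDeriv j (𝓕 φ) x‖ ^ 2 ≤ (∫ x, ‖φ x‖ ^ 2) * ((π / 2) ^ j) ^ 2 := by
  have hcs : HasCompactSupport φ :=
    HasCompactSupport.intro (isCompact_Icc (a := -(1 / 4 : ℝ)) (b := 1 / 4)) fun x hx =>
      hs x (by
        by_contra h
        have := abs_le.1 (not_lt.1 h)
        exact hx ⟨this.1, this.2⟩)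
  have hφs : HasCompactSupport (fun x : ℝ => (-2 * π * Complex.I * x) ^ j • φ x) :=
    HasCompactSupport.smul_left (f := fun x : ℝ => (-2 * π * Complex.I * x) ^ j) hcs
  have hφc : ContDiff ℝ (⊤ : ℕ∞) (fun x : ℝ => (-2 * π * Complex.I * x) ^ j • φ x) := by
    have : ContDiff ℝ (⊤ : ℕ∞) (fun v : ℝ => (v : ℂ)) := Complex.ofRealCLM.contDiff
    exact ((contDiff_const.mul this).pow j).smul hφ
  obtain ⟨Φ, hΦ⟩ : ∃ Φ : SchwartzMap ℝ ℂ, ∀ x, Φ x = (-2 * π * Complex.I * x) ^ j • φ x :=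
    ⟨hφs.toSchwartzMap hφc, fun _ => rfl⟩
  have hder : iteratedDeriv j (𝓕 φ) = 𝓕 Φ := by
    rw [Real.iteratedDeriv_fourier (N := ⊤) (fun n _ => ?_) le_top, SchwartzMap.fourier_coe]
    · congr 1
      ext x
      exact (hΦ x).symm
    · exact Continuous.integrable_of_hasCompactSupport
        ((continuous_pow n).smul hφ.continuous) hcs.smul_left
  have hΦI : Integrable (fun x => ‖Φ x‖ ^ 2) := 
    (memLp_two_iff_integrable_sq_norm Φ.continuous.aestronglyMeasurable).1 (Φ.memLp 2 volume)
  have hφI : Integrable (fun x => ‖φ x‖ ^ 2) :=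
    (memLp_two_iff_integrable_sq_norm hφ.continuous.aestronglyMeasurable).1
      (hφ.continuous.memLp_of_hasCompactSupport hcs)
  rw [hder]
  refine ⟨(memLp_two_iff_integrable_sq_norm (𝓕 Φ).continuous.aestronglyMeasurable).1
    ((𝓕 Φ).memLp 2 volume), ?_⟩
  -- Plancherel moves the estimate to `(-2πix)^j φ`, where `|x| ≤ 1/4` on the support gives the rate
  -- `π / 2`.
  rw [SchwartzMap.integral_norm_sq_fourier, ← integral_mul_const]
  refine integral_mono hΦI (hφI.mul_const _) fun x => ?_
  simp only [hΦ]
  by_cases hx : 1 / 4 < |x|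
  · simp [hs x hx]
  · rw [norm_smul, mul_pow, mul_comm, norm_pow]
    have : ‖-2 * (π : ℂ) * Complex.I * x‖ ≤ π / 2 := by
      simp only [norm_mul, norm_neg, Complex.norm_I, Complex.norm_real, Real.norm_eq_abs,
        abs_of_pos Real.pi_pos]
      have := Real.pi_pos
      norm_num
      nlinarith [not_lt.1 hx]
    gcongr

/-- `s` is the Fourier transform of a bump supported in `[-1/4, 1/4]`. Plancherel controls only `L²`
norms; `exists_multiplier` squares `s` to reach `L¹`, which doubles the rate to `π`. -/
lemma exists_sq_bound : ∃ s : ℝ → ℂ, ContDiff ℝ (⊤ : ℕ∞) s ∧ s 0 ≠ 0 ∧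
    (∃ B, ∀ x, ‖s x‖ ≤ B) ∧ (∀ j, Integrable (fun x => ‖iteratedDeriv j s x‖ ^ 2)) ∧
    ∃ M, ∀ j, ∫ x, ‖iteratedDeriv j s x‖ ^ 2 ≤ M * ((π / 2) ^ j) ^ 2 := by
  obtain ⟨b, hbc, hbcs, hb0, hbs⟩ : ∃ b : ℝ → ℝ, ContDiff ℝ (⊤ : ℕ∞) b ∧ HasCompactSupport b ∧
      0 < ∫ x, b x ∧ ∀ x, 1 / 4 < |x| → b x = 0 := by
    let b : ContDiffBump (0 : ℝ) := ⟨1 / 8, 1 / 4, by norm_num, by norm_num⟩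
    refine ⟨b, b.contDiff, b.hasCompactSupport, b.integral_pos, fun x hx => ?_⟩
    refine b.zero_of_le_dist ?_
    rw [Real.dist_eq, sub_zero]
    exact hx.le
  have hc : ContDiff ℝ (⊤ : ℕ∞) (fun x => ((b x : ℝ) : ℂ)) :=
    Complex.ofRealCLM.contDiff.comp hbc
  have hcs : HasCompactSupport (fun x => ((b x : ℝ) : ℂ)) :=
    hbcs.comp_left (g := fun y : ℝ => (y : ℂ)) (by simp)
  have hs : ∀ x, 1 / 4 < |x| → ((b x : ℝ) : ℂ) = 0 := fun x hx => by simp [hbs x hx]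
  have key := integral_sq_iteratedDeriv_fourier_le hc hs
  refine ⟨𝓕 (fun x => ((b x : ℝ) : ℂ)), ?_, ?_, ⟨∫ x, ‖((b x : ℝ) : ℂ)‖, fun x => ?_⟩,
    fun j => (key j).1, _, fun j => (key j).2⟩
  · refine Real.contDiff_fourier (N := ⊤) fun n _ => ?_
    exact Continuous.integrable_of_hasCompactSupport
        ((continuous_norm.pow n).mul hc.continuous.norm) hcs.norm.mul_left
  · have : 𝓕 (fun x => ((b x : ℝ) : ℂ)) 0 = ((∫ x, b x : ℝ) : ℂ) := by
      rw [Real.fourier_real_eq_integral_exp_smul, ← integral_complex_ofReal]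
      congr 1
      ext x
      simp
    rw [this]
    exact_mod_cast hb0.ne'
  · exact VectorFourier.norm_fourierIntegral_le_integral_norm _ _ _ _ _

/-- A smooth integrable function with value `1` at the origin whose derivatives have
geometrically bounded `L¹` norms. -/
lemma exists_multiplier : ∃ s : ℝ → ℂ, ContDiff ℝ (⊤ : ℕ∞) s ∧ s 0 = 1 ∧
    (∃ B, ∀ x, ‖s x‖ ≤ B) ∧ (∀ j, Integrable (iteratedDeriv j s)) ∧
    ∃ M, ∀ j, ∫ x, ‖iteratedDeriv j s x‖ ≤ M * π ^ j := by
  obtain ⟨t, ht, ht0, ⟨B, hB⟩, htI, M, hM⟩ := exists_sq_bound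
  have hcont : ∀ j, Continuous (iteratedDeriv j t) := fun j =>
    ht.continuous_iteratedDeriv j (by exact_mod_cast le_top)
  have hpi : (0 : ℝ) < π / 2 := by have := Real.pi_pos; positivity
  have hI : ∀ i j, Integrable (fun x => iteratedDeriv i t x * iteratedDeriv j t x) := by
    intro i j
    refine ((htI i).add (htI j)).mono' ((hcont i).mul (hcont j)).aestronglyMeasurable
      (ae_of_all _ fun x => ?_)
    rw [norm_mul]
    simp only [Pi.add_apply]
    nlinarith [sq_nonneg (‖iteratedDeriv i t x‖ - ‖iteratedDeriv j t x‖),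
      norm_nonneg (iteratedDeriv i t x), norm_nonneg (iteratedDeriv j t x)]
  have key := integral_norm_iteratedDeriv_mul_le (E := M) (α := π / 2) (β := π / 2) ht ht hI
    (fun i j => by
      set A := (π / 2) ^ i
      set C := (π / 2) ^ j
      have hA : 0 < A := by positivity
      have hC : 0 < C := by positivity
      -- Weighted AM-GM: the weights balance the two bounds `M * A ^ 2` and `M * C ^ 2` into `M * A
      -- * C`, with no loss in the rate.
      calc ∫ x, ‖iteratedDeriv i t x * iteratedDeriv j t x‖
          ≤ ∫ x, (C / (2 * A) * ‖iteratedDeriv i t x‖ ^ 2 +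
              A / (2 * C) * ‖iteratedDeriv j t x‖ ^ 2) := by
            refine integral_mono (hI i j).norm
              (((htI i).const_mul _).add ((htI j).const_mul _)) fun x => ?_
            simp only [norm_mul]
            have e : C / (2 * A) * ‖iteratedDeriv i t x‖ ^ 2 +
              A / (2 * C) * ‖iteratedDeriv j t x‖ ^ 2 - ‖iteratedDeriv i t x‖ * ‖iteratedDeriv j t x‖
              = (C * ‖iteratedDeriv i t x‖ - A * ‖iteratedDeriv j t x‖) ^ 2 / (2 * A * C) := by
              field_simp
              ring
            have h2 : 0 ≤ (C * ‖iteratedDeriv i t x‖ - A * ‖iteratedDeriv j t x‖) ^ 2 / (2 * A * C) := by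
              positivity
            linarith
        _ = C / (2 * A) * (∫ x, ‖iteratedDeriv i t x‖ ^ 2) +
              A / (2 * C) * ∫ x, ‖iteratedDeriv j t x‖ ^ 2 := by
            rw [integral_add ((htI i).const_mul _) ((htI j).const_mul _), integral_const_mul,
              integral_const_mul]
        _ ≤ C / (2 * A) * (M * A ^ 2) + A / (2 * C) * (M * C ^ 2) := by
            gcongr
            exacts [hM i, hM j]
        _ = M * A * C := by
            field_simp
            ring)
  have e : ∀ j, iteratedDeriv j (fun x => (t * t) x * ((t 0) ^ 2)⁻¹) =
      fun x => iteratedDeriv j (t * t) x * ((t 0) ^ 2)⁻¹ := by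
    intro j
    ext x
    exact iteratedDeriv_mul_const_field (t * t) (((t 0) ^ 2)⁻¹)
  refine ⟨fun x => (t * t) x * ((t 0) ^ 2)⁻¹, (ht.mul ht).mul contDiff_const, ?_,
    ⟨B * B * ‖((t 0) ^ 2)⁻¹‖, fun x => ?_⟩, fun j => ?_, M * ‖((t 0) ^ 2)⁻¹‖, fun j => ?_⟩
  · simp only [Pi.mul_apply]
    field_simp
  · simp only [Pi.mul_apply, norm_mul (t x * t x), norm_mul (t x)]
    have := norm_nonneg (t x)
    have := hB x
    gcongr
    linarith
  · rw [e]
    exact (key j).1.mul_const _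
  · simp only [e, norm_mul, integral_mul_const]
    have := (key j).2
    rw [add_halves] at this
    calc _ ≤ M * π ^ j * ‖((t 0) ^ 2)⁻¹‖ := by gcongr
      _ = _ := by ring

/-- The Fourier transform of a function with geometrically bounded derivatives in `L¹` is
supported in the corresponding interval. -/
lemma fourier_eq_zero_of_integral_iteratedDeriv_le {g : ℝ → ℂ} (hg : ContDiff ℝ (⊤ : ℕ∞) g)
    (hI : ∀ k, Integrable (iteratedDeriv k g)) {K : ℝ}
    (hK : ∀ k, ∫ x, ‖iteratedDeriv k g x‖ ≤ K * π ^ k) {ξ : ℝ} (hξ : ξ ∉ Icc (-(1 / 2) : ℝ) (1 / 2)) :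
    𝓕 g ξ = 0 := by
  have h1 : 1 < |2 * ξ| := by
    by_contra h
    have := abs_le.1 (not_lt.1 h)
    exact hξ ⟨by linarith [this.1], by linarith [this.2]⟩
  -- Each derivative multiplies the transform by `2πiξ`, so this product stays bounded in `k`
  -- although `|2ξ| > 1`.
  have hle : ∀ k : ℕ, |2 * ξ| ^ k * ‖𝓕 g ξ‖ ≤ K := by
    intro k
    have hF := congrFun (Real.fourier_iteratedDeriv (N := ⊤) hg (fun n _ => hI n) (n := k) le_top) ξ
    have hn : ‖𝓕 (iteratedDeriv k g) ξ‖ ≤ K * π ^ k :=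
      (VectorFourier.norm_fourierIntegral_le_integral_norm _ _ _ _ _).trans (hK k)
    rw [hF, norm_smul, norm_pow] at hn
    have e : ‖2 * (π : ℂ) * Complex.I * ξ‖ = |2 * ξ| * π := by
      simp only [norm_mul, Complex.norm_I, Complex.norm_real, Real.norm_eq_abs,
          abs_of_pos Real.pi_pos, abs_mul]
      norm_num
      ring
    rw [e, mul_pow] at hn
    have hp : 0 < π ^ k := by have := Real.pi_pos; positivity
    nlinarith
  by_contra hne
  have hpos : 0 < ‖𝓕 g ξ‖ := norm_pos_iff.2 hne
  obtain ⟨n, hn⟩ := pow_unbounded_of_one_lt (K / ‖𝓕 g ξ‖) h1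
  rw [div_lt_iff₀ hpos] at hn
  exact absurd (hle n) (not_le.2 hn)

/-- Fourier inversion at a point, with the exponential written out. -/
lemma eq_integral_exp_mul_fourier {g : ℝ → ℂ} (hg : Continuous g) (hI : Integrable g)
    (hF : Integrable (𝓕 g)) (x : ℝ) :
    g x = ∫ ξ : ℝ, Complex.exp (2 * π * Complex.I * ξ * x) * 𝓕 g ξ := by
  have h := hI.fourierInv_fourier_eq hF (v := x) hg.continuousAt
  rw [← h, Real.fourierInv_eq']
  congr 1
  ext ξ
  rw [smul_eq_mul]
  congr 2
  simp
  ring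

/-- The Riesz-Boas formula at the origin for integrable band-limited functions. -/
lemma hasSum_nodeCoeff_of_integrable {g : ℝ → ℂ} (hg : ContDiff ℝ (⊤ : ℕ∞) g)
    (hI : ∀ k, Integrable (iteratedDeriv k g)) {K : ℝ}
    (hK : ∀ k, ∫ x, ‖iteratedDeriv k g x‖ ≤ K * π ^ k) (r : ℕ) :
    HasSum (fun k => (nodeCoeff r k : ℂ) * g (node r k)) (iteratedDeriv r g 0) := by
  have hzero : ∀ ξ, ξ ∉ Icc (-(1 / 2) : ℝ) (1 / 2) → 𝓕 g ξ = 0 := fun ξ hξ =>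
    fourier_eq_zero_of_integral_iteratedDeriv_le hg hI hK hξ
  have hgI : Integrable g := by simpa using hI 0
  have hFc : Continuous (𝓕 g) :=
    VectorFourier.fourierIntegral_continuous Real.continuous_fourierChar
      (by exact continuous_inner) hgI
  have hsupp : HasCompactSupport (𝓕 g) :=
    HasCompactSupport.intro isCompact_Icc hzero
  have hFI : Integrable (𝓕 g) := hFc.integrable_of_hasCompactSupport hsupp
  have hinv := eq_integral_exp_mul_fourier hg.continuous hgI hFI
  have hFr := Real.fourier_iteratedDeriv (N := ⊤) hg (fun n _ => hI n) (n := r) le_top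
  have hinvr := eq_integral_exp_mul_fourier
    (hg.continuous_iteratedDeriv r (by exact_mod_cast le_top)) (hI r)
  rw [hFr] at hinvr
  generalize 𝓕 g = w at *
  have hw : ∀ q : ℝ → ℂ, Continuous q → Integrable (fun ξ => q ξ * w ξ) := fun q hq =>
    Continuous.integrable_of_hasCompactSupport (hq.mul hFc) hsupp.mul_left
  have hinvr0 : iteratedDeriv r g 0 = ∫ ξ : ℝ, (2 * π * Complex.I * ξ) ^ r * w ξ := by
    rw [hinvr (by simpa only [smul_eq_mul] using hw _ (by fun_prop)) 0]
    simp
  have hterm : ∀ k : ℤ, Integrable (fun ξ : ℝ => (nodeCoeff r k : ℂ) *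
      (Complex.exp (2 * π * Complex.I * ξ * node r k) * w ξ)) := fun k =>
    (hw _ (by fun_prop)).const_mul _
  have hnorm : ∀ (k : ℤ) (ξ : ℝ), ‖(nodeCoeff r k : ℂ) *
      (Complex.exp (2 * π * Complex.I * ξ * node r k) * w ξ)‖ = |nodeCoeff r k| * ‖w ξ‖ := by
    intro k ξ
    have : 2 * π * Complex.I * ξ * node r k = ((2 * π * ξ * node r k : ℝ) : ℂ) * Complex.I := by
      push_cast; ring
    rw [norm_mul, norm_mul, this, Complex.norm_exp_ofReal_mul_I, one_mul, Complex.norm_real,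
      Real.norm_eq_abs]
  have hs : Summable fun k : ℤ => ∫ ξ : ℝ, ‖(nodeCoeff r k : ℂ) *
      (Complex.exp (2 * π * Complex.I * ξ * node r k) * w ξ)‖ := by
    simp only [hnorm, integral_const_mul]
    exact (summable_nodeCoeff r).mul_right _
  have hsum := hasSum_integral_of_summable_integral_norm hterm hs
  -- The expansion of `(2πiξ)^r` is available only on `[-1/2, 1/2]`; elsewhere both sides vanish
  -- with the transform.
  have e1 : ∀ ξ : ℝ, ∑' k : ℤ, (nodeCoeff r k : ℂ) *
      (Complex.exp (2 * π * Complex.I * ξ * node r k) * w ξ) =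
      (2 * π * Complex.I * ξ) ^ r * w ξ := by
    intro ξ
    by_cases hξ : ξ ∈ Icc (-(1 / 2) : ℝ) (1 / 2)
    · simp only [← mul_assoc]
      exact ((hasSum_nodeCoeff_exp r hξ).mul_right _).tsum_eq
    · simp [hzero ξ hξ]
  simp only [e1, ← hinvr0, integral_const_mul, ← hinv] at hsum
  exact hsum

end

/-! ### The Riesz-Boas formula for bounded functions. -/

section

open scoped ENNReal FourierTransform Real

/-- The Riesz-Boas formula at the origin for a bounded band-limited function multiplied by an
integrable dilated multiplier. -/
lemma hasSum_nodeCoeff_mul_dilation {H s : ℝ → ℂ} (hH : ContDiff ℝ (⊤ : ℕ∞) H) {C : ℝ}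
    (hC : ∀ k x, ‖iteratedDeriv k H x‖ ≤ C * π ^ k) (hs : ContDiff ℝ (⊤ : ℕ∞) s)
    (hsI : ∀ j, Integrable (iteratedDeriv j s)) {M : ℝ}
    (hM : ∀ j, ∫ x, ‖iteratedDeriv j s x‖ ≤ M * π ^ j) {b : ℝ} (hb : 0 < b) (hb1 : b ≤ 1) (r : ℕ) :
    HasSum (fun k => (nodeCoeff r k : ℂ) * (H ((1 - b) * node r k) * s (b * node r k)))
      (∑ i ∈ Finset.range (r + 1), (r.choose i : ℂ) * ((1 - b : ℝ) ^ i * iteratedDeriv i H 0) *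
        (b ^ (r - i) * iteratedDeriv (r - i) s 0)) := by
  -- Types add: `(1 - b) * π` from the bounded factor and `b * π` from the integrable one make
  -- exactly `π`.
  set u : ℝ → ℂ := fun x => H ((1 - b) * x) with hu
  set v : ℝ → ℂ := fun x => s (b * x) with hv
  have hu' : ContDiff ℝ (⊤ : ℕ∞) u := hH.comp (contDiff_const.mul contDiff_id)
  have hv' : ContDiff ℝ (⊤ : ℕ∞) v := hs.comp (contDiff_const.mul contDiff_id)
  have hui : ∀ i, iteratedDeriv i u = fun x => (1 - b) ^ i • iteratedDeriv i H ((1 - b) * x) :=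
    fun i => iteratedDeriv_comp_const_smul (hH.of_le (by exact_mod_cast le_top)) (1 - b)
  have hvi : ∀ i, iteratedDeriv i v = fun x => b ^ i • iteratedDeriv i s (b * x) :=
    fun i => iteratedDeriv_comp_const_smul (hs.of_le (by exact_mod_cast le_top)) b
  have hvI : ∀ j, Integrable (iteratedDeriv j v) := fun j => by
    rw [hvi]
    exact ((hsI j).comp_mul_left' hb.ne').smul (b ^ j)
  have hvM : ∀ j, ∫ x, ‖iteratedDeriv j v x‖ ≤ M / b * (b * π) ^ j := fun j => by
    simp only [hvi, norm_smul, norm_pow, Real.norm_of_nonneg hb.le, integral_const_mul]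
    rw [Measure.integral_comp_mul_left (fun y => ‖iteratedDeriv j s y‖) b, abs_of_pos (inv_pos.2 hb),
      smul_eq_mul, mul_pow]
    calc b ^ j * (b⁻¹ * ∫ y, ‖iteratedDeriv j s y‖) ≤ b ^ j * (b⁻¹ * (M * π ^ j)) := by
          gcongr; exact hM j
      _ = _ := by ring
  have huB : ∀ i x, ‖iteratedDeriv i u x‖ ≤ C * ((1 - b) * π) ^ i := fun i x => by
    simp only [hui, norm_smul, norm_pow, Real.norm_of_nonneg (sub_nonneg.2 hb1), mul_pow]
    calc (1 - b) ^ i * ‖iteratedDeriv i H ((1 - b) * x)‖ ≤ (1 - b) ^ i * (C * π ^ i) := by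
          have : 0 ≤ 1 - b := sub_nonneg.2 hb1
          gcongr; exact hC i _
      _ = _ := by ring
  have hint : ∀ i j, Integrable (fun x => iteratedDeriv i u x * iteratedDeriv j v x) := fun i j =>
    (hvI j).bdd_mul
      (hu'.continuous_iteratedDeriv i (by exact_mod_cast le_top)).aestronglyMeasurable
      (ae_of_all _ (huB i))
  have key := integral_norm_iteratedDeriv_mul_le hu' hv' (E := C * (M / b)) (α := (1 - b) * π)
    (β := b * π) hint (fun i j => by
      calc ∫ x, ‖iteratedDeriv i u x * iteratedDeriv j v x‖
          ≤ ∫ x, C * ((1 - b) * π) ^ i * ‖iteratedDeriv j v x‖ := by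
            refine integral_mono (hint i j).norm ((hvI j).norm.const_mul _) fun x => ?_
            simp only [norm_mul]
            gcongr
            exact huB i x
        _ = C * ((1 - b) * π) ^ i * ∫ x, ‖iteratedDeriv j v x‖ := integral_const_mul _ _
        _ ≤ C * ((1 - b) * π) ^ i * (M / b * (b * π) ^ j) := by
            have : 0 ≤ C * ((1 - b) * π) ^ i := (norm_nonneg _).trans (huB i 0)
            gcongr
            exact hvM j
        _ = _ := by ring)
  have e : (1 - b) * π + b * π = π := by ring
  rw [e] at key
  have := hasSum_nodeCoeff_of_integrable (hu'.mul hv') (fun k => (key k).1) (fun k => (key k).2) r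
  rw [iteratedDeriv_fun_mul (hu'.contDiffAt.of_le (by exact_mod_cast le_top))
      (hv'.contDiffAt.of_le (by exact_mod_cast le_top))] at this
  convert! this using 1
  refine Finset.sum_congr rfl fun i _ => ?_
  simp only [hui, hvi, mul_zero, Complex.real_smul]
  push_cast
  ring

/-- The Riesz-Boas formula at the origin for bounded functions of exponential type `π`. -/
theorem hasSum_nodeCoeff_of_bounded {H : ℝ → ℂ} (hH : ContDiff ℝ (⊤ : ℕ∞) H) {C : ℝ}
    (hC : ∀ k x, ‖iteratedDeriv k H x‖ ≤ C * π ^ k) (r : ℕ) :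
    HasSum (fun k => (nodeCoeff r k : ℂ) * H (node r k)) (iteratedDeriv r H 0) := by
  obtain ⟨s, hs, hs0, ⟨B, hB⟩, hsI, M, hM⟩ := exists_multiplier
  have hC0 : ∀ x, ‖H x‖ ≤ C := fun x => by simpa using hC 0 x
  have hC' : 0 ≤ C := (norm_nonneg _).trans (hC0 0)
  have hsum : Summable (fun k => |nodeCoeff r k| * (C * B)) := (summable_nodeCoeff r).mul_right _
  have hS : Summable (fun k => (nodeCoeff r k : ℂ) * H (node r k)) := by
    refine Summable.of_norm_bounded ((summable_nodeCoeff r).mul_right C) fun k => ?_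
    rw [norm_mul, Complex.norm_real, Real.norm_eq_abs]
    gcongr
    exact hC0 _
  have hb : Tendsto (fun b : ℝ => b) (𝓝[>] 0) (𝓝 0) := tendsto_nhdsWithin_of_tendsto_nhds tendsto_id
  have h1b : Tendsto (fun b : ℝ => 1 - b) (𝓝[>] 0) (𝓝 1) := by
    simpa using (tendsto_const_nhds (x := (1 : ℝ))).sub hb
  have hl : Tendsto (fun b : ℝ => ∑' k, (nodeCoeff r k : ℂ) *
      (H ((1 - b) * node r k) * s (b * node r k))) (𝓝[>] 0)
      (𝓝 (∑' k, (nodeCoeff r k : ℂ) * H (node r k))) := by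
    refine tendsto_tsum_of_dominated_convergence hsum (fun k => ?_) (Eventually.of_forall fun b k => ?_)
    · have h1 : Tendsto (fun b : ℝ => H ((1 - b) * node r k)) (𝓝[>] 0) (𝓝 (H (node r k))) := by
        have := (hH.continuous.tendsto (1 * node r k)).comp (h1b.mul_const (node r k))
        simpa [Function.comp_def] using this
      have h2 : Tendsto (fun b : ℝ => s (b * node r k)) (𝓝[>] 0) (𝓝 1) := by
        have := (hs.continuous.tendsto (0 * node r k)).comp (hb.mul_const (node r k))
        simpa [Function.comp_def, hs0] using this
      simpa using (h1.mul h2).const_mul (nodeCoeff r k : ℂ)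
    · rw [norm_mul, norm_mul, Complex.norm_real, Real.norm_eq_abs]
      gcongr
      exacts [hC0 _, hB _]
  have hrt : Tendsto (fun b : ℝ => ∑ i ∈ Finset.range (r + 1), (r.choose i : ℂ) *
      ((1 - b : ℝ) ^ i * iteratedDeriv i H 0) * (b ^ (r - i) * iteratedDeriv (r - i) s 0)) (𝓝[>] 0)
      (𝓝 (∑ i ∈ Finset.range (r + 1), (r.choose i : ℂ) *
      ((1 - (0 : ℝ) : ℝ) ^ i * iteratedDeriv i H 0) *
        (((0 : ℝ) : ℂ) ^ (r - i) * iteratedDeriv (r - i) s 0))) := by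
    refine Tendsto.mono_left (Continuous.tendsto ?_ 0) nhdsWithin_le_nhds
    fun_prop
  -- At `b = 0` the Leibniz sum collapses to `i = r`, because `0 ^ (r - i) = 0` otherwise and `s 0 =
  -- 1`.
  have e0 : (∑ i ∈ Finset.range (r + 1), (r.choose i : ℂ) *
      ((1 - (0 : ℝ) : ℝ) ^ i * iteratedDeriv i H 0) *
        (((0 : ℝ) : ℂ) ^ (r - i) * iteratedDeriv (r - i) s 0)) = iteratedDeriv r H 0 := by
    rw [Finset.sum_eq_single r]
    · simp [hs0]
    · intro i hi hne
      have : r - i ≠ 0 := by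
        have := Finset.mem_range.1 hi
        omega
      simp [this]
    · simp
  rw [e0] at hrt
  have heq : (fun b : ℝ => ∑' k, (nodeCoeff r k : ℂ) *
      (H ((1 - b) * node r k) * s (b * node r k))) =ᶠ[𝓝[>] 0] (fun b : ℝ =>
      ∑ i ∈ Finset.range (r + 1), (r.choose i : ℂ) *
      ((1 - b : ℝ) ^ i * iteratedDeriv i H 0) * (b ^ (r - i) * iteratedDeriv (r - i) s 0)) := by
    filter_upwards [Ioc_mem_nhdsGT (zero_lt_one' ℝ)] with b hb
    exact (hasSum_nodeCoeff_mul_dilation hH hC hs hsI hM hb.1 hb.2 r).tsum_eq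
  rw [tendsto_nhds_unique (hrt.congr' heq.symm) hl]
  exact hS.hasSum

/-- The coefficient of the Riesz-Boas series of order `r` and type `σ`. -/
def rbCoeff (σ : ℝ) (r : ℕ) (k : ℤ) : ℝ := (σ / π) ^ r * nodeCoeff r k

/-- The translation of the Riesz-Boas series of order `r` and type `σ`. -/
def rbNode (σ : ℝ) (r : ℕ) (k : ℤ) : ℝ := π / σ * node r k

lemma summable_rbCoeff (σ : ℝ) (r : ℕ) : Summable (fun k => |rbCoeff σ r k|) := by
  simp only [rbCoeff, abs_mul]
  exact (summable_nodeCoeff r).mul_left _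

lemma tsum_abs_rbCoeff_one {σ : ℝ} (hσ : 0 < σ) : ∑' k, |rbCoeff σ 1 k| = σ := by
  have : 0 < σ / π := div_pos hσ Real.pi_pos
  simp only [rbCoeff, abs_mul, pow_one, abs_of_pos this]
  rw [tsum_mul_left, tsum_abs_nodeCoeff_one, div_mul_cancel₀ _ Real.pi_ne_zero]

/-- The Riesz-Boas formula for bounded functions of exponential type `σ`. -/
theorem hasSum_rbCoeff {F : ℝ → ℂ} (hF : ContDiff ℝ (⊤ : ℕ∞) F) {σ : ℝ} (hσ : 0 < σ) {C : ℝ}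
    (hC : ∀ k x, ‖iteratedDeriv k F x‖ ≤ C * σ ^ k) (r : ℕ) (u : ℝ) :
    HasSum (fun k => (rbCoeff σ r k : ℂ) * F (u + rbNode σ r k)) (iteratedDeriv r F u) := by
  have hpi := Real.pi_pos
  have hc : 0 < π / σ := div_pos hpi hσ
  have hcd : ContDiff ℝ (⊤ : ℕ∞) (fun z => F (u + z)) := hF.comp (contDiff_const.add contDiff_id)
  have hd : ∀ k, iteratedDeriv k (fun t => F (u + π / σ * t)) =
      fun t => (π / σ) ^ k • iteratedDeriv k F (u + π / σ * t) := by
    intro k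
    have := iteratedDeriv_comp_const_smul (n := k) (hcd.of_le (by exact_mod_cast le_top)) (π / σ)
    rw [iteratedDeriv_comp_const_add] at this
    exact this
  have h := hasSum_nodeCoeff_of_bounded (H := fun t => F (u + π / σ * t)) (C := C)
    (hcd.comp (contDiff_const.mul contDiff_id)) (fun k x => by
      simp only [hd, norm_smul, norm_pow, Real.norm_of_nonneg hc.le]
      calc (π / σ) ^ k * ‖iteratedDeriv k F (u + π / σ * x)‖ ≤ (π / σ) ^ k * (C * σ ^ k) := by
            gcongr; exact hC k _
        _ = C * π ^ k := by
            rw [div_pow]; field_simp) r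
  have h2 := h.mul_left (((σ / π) ^ r : ℝ) : ℂ)
  convert! h2 using 1
  · ext k
    simp only [rbCoeff, rbNode]
    push_cast
    ring
  · simp only [hd, mul_zero, add_zero, Complex.real_smul]
    rw [← mul_assoc, ← Complex.ofReal_mul, ← mul_pow]
    have : σ / π * (π / σ) = 1 := by field_simp
    rw [this]
    simp

end

/-! ### The norm in the logarithmic variable and the substitution `x = e^u`. -/

section

open scoped ENNReal Real

/-- The norm of `X^p(ℝ₊)` in the logarithmic variable: the `L^p(ℝ)`-norm for `p < ∞` and the
supremum for `p = ∞`. -/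
def LNorm (p : ℝ≥0∞) (G : ℝ → ℂ) : ℝ≥0∞ :=
  if p = ∞ then ⨆ u, ‖G u‖ₑ else eLpNorm G p volume

/-- Equality in the function space: almost everywhere, and everywhere if `p = ∞`. -/
def LEq (p : ℝ≥0∞) (G H : ℝ → ℂ) : Prop := (p = ∞ → G = H) ∧ G =ᵐ[volume] H

section norm

variable {p : ℝ≥0∞} {G H K : ℝ → ℂ}

lemma lNorm_top (G : ℝ → ℂ) : LNorm ∞ G = ⨆ u, ‖G u‖ₑ := if_pos rfl

lemma lNorm_of_ne_top (hp : p ≠ ∞) (G : ℝ → ℂ) : LNorm p G = eLpNorm G p volume := if_neg hp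

lemma LEq.refl (p : ℝ≥0∞) (G : ℝ → ℂ) : LEq p G G := ⟨fun _ => rfl, EventuallyEq.rfl⟩

lemma LEq.symm (h : LEq p G H) : LEq p H G := ⟨fun hp => (h.1 hp).symm, h.2.symm⟩

lemma LEq.trans (h : LEq p G H) (h' : LEq p H K) : LEq p G K :=
  ⟨fun hp => (h.1 hp).trans (h'.1 hp), h.2.trans h'.2⟩

lemma LEq.lNorm_eq (h : LEq p G H) : LNorm p G = LNorm p H := by
  by_cases hp : p = ∞
  · rw [h.1 hp]
  · rw [lNorm_of_ne_top hp, lNorm_of_ne_top hp, eLpNorm_congr_ae h.2]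

lemma LEq.sub {G' H' : ℝ → ℂ} (h : LEq p G H) (h' : LEq p G' H') :
    LEq p (fun u => G u - G' u) (fun u => H u - H' u) :=
  ⟨fun hp => by rw [h.1 hp, h'.1 hp], h.2.sub h'.2⟩

lemma LEq.const_mul (h : LEq p G H) (c : ℂ) : LEq p (fun u => c * G u) (fun u => c * H u) :=
  ⟨fun hp => by rw [h.1 hp], h.2.mono fun u hu => by simp only [hu]⟩

lemma LEq.translate (h : LEq p G H) (t : ℝ) : LEq p (fun u => G (u + t)) (fun u => H (u + t)) :=
  ⟨fun hp => by rw [h.1 hp],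
    (measurePreserving_add_right volume t).quasiMeasurePreserving.ae_eq_comp h.2⟩

lemma LEq.sum {ι : Type*} {s : Finset ι} {f g : ι → ℝ → ℂ} (h : ∀ i, LEq p (f i) (g i)) :
    LEq p (fun u => ∑ i ∈ s, f i u) (fun u => ∑ i ∈ s, g i u) := by
  classical
  induction s using Finset.induction_on with
  | empty => simpa using LEq.refl p _
  | insert a s ha ih =>
    simp only [Finset.sum_insert ha]
    exact ⟨fun hp => by
      have h1 := congrFun (ih.1 hp)
      have h2 := congrFun ((h a).1 hp)
      ext u
      rw [h1, h2], (h a).2.add ih.2⟩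

lemma LEq.eq_of_continuous (h : LEq p G H) (hG : Continuous G) (hH : Continuous H) : G = H :=
  (hG.ae_eq_iff_eq volume hH).1 h.2

/-- The supremum dominates the essential supremum, so estimates of `eLpNorm` serve all `p` at once.
-/
lemma eLpNorm_le_lNorm (p : ℝ≥0∞) (G : ℝ → ℂ) : eLpNorm G p volume ≤ LNorm p G := by
  by_cases hp : p = ∞
  · subst hp
    rw [lNorm_top, eLpNorm_exponent_top]
    exact eLpNormEssSup_le_of_ae_enorm_bound (ae_of_all _ fun u => le_iSup (fun u => ‖G u‖ₑ) u)
  · rw [lNorm_of_ne_top hp]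

lemma lNorm_sub_eq_zero_iff (hp : p ≠ 0) (hG : AEStronglyMeasurable G volume)
    (hH : AEStronglyMeasurable H volume) :
    LNorm p (fun u => G u - H u) = 0 ↔ LEq p G H := by
  constructor
  · intro h
    refine ⟨fun hp => ?_, ?_⟩
    · subst hp
      rw [lNorm_top] at h
      ext u
      have := (ENNReal.iSup_eq_zero.1 h) u
      exact sub_eq_zero.1 (enorm_eq_zero.1 this)
    · have h0 : eLpNorm (fun u => G u - H u) p volume = 0 :=
        le_antisymm ((eLpNorm_le_lNorm p _).trans h.le) zero_le
      have := (eLpNorm_eq_zero_iff (hG.sub hH) hp).1 h0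
      exact this.mono fun u hu => sub_eq_zero.1 hu
  · intro h
    have := (h.sub (LEq.refl p H)).lNorm_eq
    rw [this]
    unfold LNorm
    simp

lemma lNorm_add_le (hp : 1 ≤ p) (hG : AEStronglyMeasurable G volume)
    (hH : AEStronglyMeasurable H volume) :
    LNorm p (fun u => G u + H u) ≤ LNorm p G + LNorm p H := by
  by_cases h : p = ∞
  · subst h
    simp only [lNorm_top]
    exact iSup_le fun u => (enorm_add_le _ _).trans
      (add_le_add (le_iSup (fun u => ‖G u‖ₑ) u) (le_iSup (fun u => ‖H u‖ₑ) u))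
  · simp only [lNorm_of_ne_top h]
    exact eLpNorm_add_le hG hH hp

lemma lNorm_const_mul (c : ℂ) (G : ℝ → ℂ) : LNorm p (fun u => c * G u) = ‖c‖ₑ * LNorm p G := by
  by_cases h : p = ∞
  · subst h
    simp only [lNorm_top, enorm_mul, ENNReal.mul_iSup]
  · simp only [lNorm_of_ne_top h]
    exact eLpNorm_const_smul c G p volume

lemma lNorm_sub_comm (G H : ℝ → ℂ) :
    LNorm p (fun u => G u - H u) = LNorm p (fun u => H u - G u) := by
  have := lNorm_const_mul (p := p) (-1) (fun u => H u - G u)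
  simpa using this

lemma lNorm_translate (hG : AEStronglyMeasurable G volume) (t : ℝ) :
    LNorm p (fun u => G (u + t)) = LNorm p G := by
  by_cases h : p = ∞
  · subst h
    simp only [lNorm_top]
    exact (Equiv.addRight t).iSup_comp (g := fun u => ‖G u‖ₑ)
  · simp only [lNorm_of_ne_top h]
    exact eLpNorm_comp_measurePreserving hG (measurePreserving_add_right volume t)

lemma AEStronglyMeasurable.translate (hG : AEStronglyMeasurable G volume) (t : ℝ) :
    AEStronglyMeasurable (fun u => G (u + t)) volume :=
  hG.comp_measurePreserving (measurePreserving_add_right volume t)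

lemma lNorm_le_tsum_nat (hp : 1 ≤ p) {f : ℕ → ℝ → ℂ}
    (hf : ∀ i, AEStronglyMeasurable (f i) volume) (hs : ∀ u, HasSum (fun i => f i u) (G u)) :
    LNorm p G ≤ ∑' i, LNorm p (f i) := by
  by_cases h : p = ∞
  · subst h
    simp only [lNorm_top]
    refine iSup_le fun u => ?_
    rw [← (hs u).tsum_eq]
    exact enorm_tsum_le_tsum_enorm.trans
      (ENNReal.tsum_le_tsum fun i => le_iSup (fun u => ‖f i u‖ₑ) u)
  · simp only [lNorm_of_ne_top h]
    have hm : ∀ n, AEStronglyMeasurable (fun u => ∑ i ∈ Finset.range n, f i u) volume := fun n =>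
      Finset.aestronglyMeasurable_fun_sum _ fun i _ => hf i
    -- Fatou's lemma, applied to the partial sums.
    refine (Lp.eLpNorm_lim_le_liminf_eLpNorm (p := p) hm G
      (ae_of_all _ fun u => (hs u).tendsto_sum_nat)).trans ?_
    refine (liminf_le_liminf (v := fun _ => ∑' i, eLpNorm (f i) p volume)
      (Eventually.of_forall fun n => ?_)).trans (le_of_eq (liminf_const _))
    have e : (fun u => ∑ i ∈ Finset.range n, f i u) = ∑ i ∈ Finset.range n, f i := by
      ext u; simp
    rw [e]
    exact (eLpNorm_sum_le (fun i _ => hf i) hp).trans (ENNReal.sum_le_tsum _)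

/-- The triangle inequality for pointwise convergent series. -/
lemma lNorm_le_tsum {ι : Type*} [Denumerable ι] (hp : 1 ≤ p) {f : ι → ℝ → ℂ}
    (hf : ∀ i, AEStronglyMeasurable (f i) volume) (hs : ∀ u, HasSum (fun i => f i u) (G u)) :
    LNorm p G ≤ ∑' i, LNorm p (f i) := by
  rw [← (Denumerable.eqv ι).symm.tsum_eq]
  exact lNorm_le_tsum_nat hp (fun i => hf _) fun u => (Denumerable.eqv ι).symm.hasSum_iff.2 (hs u)

/-- A pointwise convergent series whose terms have summable norms converges in norm. -/
lemma tendsto_lNorm_sum_sub {ι : Type*} [Denumerable ι] (hp : 1 ≤ p) {f : ι → ℝ → ℂ}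
    (hf : ∀ i, AEStronglyMeasurable (f i) volume) (hs : ∀ u, HasSum (fun i => f i u) (G u))
    (hfin : ∑' i, LNorm p (f i) ≠ ∞) :
    Tendsto (fun s : Finset ι => LNorm p (fun u => (∑ i ∈ s, f i u) - G u)) atTop (𝓝 0) := by
  classical
  refine tendsto_of_tendsto_of_tendsto_of_le_of_le tendsto_const_nhds
    (ENNReal.tendsto_tsum_compl_atTop_zero hfin) (fun _ => zero_le) fun s => ?_
  simp only
  rw [lNorm_sub_comm]
  -- The remainder is itself a pointwise convergent series, with the terms in `s` replaced by zero,
  -- so the tail of the norms bounds it.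
  have e : ∑' i : { x // x ∉ s }, LNorm p (f i) =
      ∑' i, LNorm p (if i ∈ s then (fun _ => 0) else f i) := by
    refine (tsum_subtype {x | x ∉ s} (fun i => LNorm p (f i))).trans ?_
    congr 1
    ext i
    by_cases hi : i ∈ s
    · simp [hi, LNorm]
    · simp [hi]
  rw [e]
  refine lNorm_le_tsum hp (fun i => ?_) fun u => ?_
  · split_ifs
    exacts [aestronglyMeasurable_const, hf i]
  · have h1 : HasSum (fun i => if i ∈ s then f i u else 0) (∑ i ∈ s, f i u) := by
      have := hasSum_sum_of_ne_finset_zero (L := .unconditional ι) (f := fun i => if i ∈ s then f i u else 0) (s := s)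
        (fun i hi => if_neg hi)
      rwa [Finset.sum_congr rfl (fun i hi => if_pos hi)] at this
    convert! (hs u).sub h1 using 1
    ext i
    split_ifs <;> simp

end norm

section change

/-- The preimage under `exp` is an image under `log`, and differentiable maps send null sets to null
sets. Together with the converse for `log`, this transfers measurability between `ℝ₊` and `ℝ`. -/
lemma quasiMeasurePreserving_exp :
    Measure.QuasiMeasurePreserving Real.exp volume (volume.restrict (Ioi (0 : ℝ))) := by
  refine ⟨Real.measurable_exp, Measure.AbsolutelyContinuous.mk fun s hs h0 => ?_⟩
  rw [Measure.map_apply Real.measurable_exp hs]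
  rw [Measure.restrict_apply hs] at h0
  have e : Real.exp ⁻¹' s = Real.log '' (s ∩ Ioi 0) := by
    ext u
    constructor
    · intro hu
      exact ⟨Real.exp u, ⟨hu, Real.exp_pos u⟩, Real.log_exp u⟩
    · rintro ⟨x, ⟨hx, hx0⟩, rfl⟩
      simpa [Real.exp_log hx0] using hx
  rw [e]
  refine addHaar_image_eq_zero_of_differentiableOn_of_addHaar_eq_zero volume ?_ h0
  exact fun x hx => (Real.differentiableAt_log (ne_of_gt hx.2)).differentiableWithinAt

lemma quasiMeasurePreserving_log :
    Measure.QuasiMeasurePreserving Real.log (volume.restrict (Ioi (0 : ℝ))) volume := by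
  refine ⟨Real.measurable_log, Measure.AbsolutelyContinuous.mk fun s hs h0 => ?_⟩
  rw [Measure.map_apply Real.measurable_log hs, Measure.restrict_apply (Real.measurable_log hs)]
  have e : Real.log ⁻¹' s ∩ Ioi 0 ⊆ Real.exp '' s := by
    rintro x ⟨hx, hx0⟩
    exact ⟨Real.log x, hx, Real.exp_log hx0⟩
  refine measure_mono_null e ?_
  exact addHaar_image_eq_zero_of_differentiableOn_of_addHaar_eq_zero volume
    Real.differentiable_exp.differentiableOn h0

variable {p : ℝ≥0∞} {f g : ℝ → ℂ}

lemma aestronglyMeasurable_comp_exp_iff :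
    AEStronglyMeasurable (fun u => f (Real.exp u)) volume ↔
      AEStronglyMeasurable f (volume.restrict (Ioi (0 : ℝ))) := by
  constructor
  · intro h
    refine (h.comp_quasiMeasurePreserving quasiMeasurePreserving_log).congr ?_
    filter_upwards [ae_restrict_mem measurableSet_Ioi] with x hx
    simp [Real.exp_log hx]
  · exact fun h => h.comp_quasiMeasurePreserving quasiMeasurePreserving_exp

/-- The substitution `x = e^u` identifies `X^p(ℝ₊)` with the space over `ℝ`. -/
lemma xNorm_eq_lNorm (hp : 1 ≤ p) (f : ℝ → ℂ) :
    XNorm p f = LNorm p (fun u => f (Real.exp u)) := by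
  by_cases h : p = ∞
  · subst h
    rw [XNorm, if_pos rfl, lNorm_top]
    refine le_antisymm (iSup₂_le fun x hx => ?_) (iSup_le fun u => ?_)
    · refine le_trans (le_of_eq ?_) (le_iSup (fun u => ‖f (Real.exp u)‖ₑ) (Real.log x))
      simp [Real.exp_log hx]
    · exact le_iSup₂ (f := fun (x : ℝ) (_ : x ∈ Ioi (0 : ℝ)) => ‖f x‖ₑ) (Real.exp u) (Real.exp_pos u)
  · have hp0 : p ≠ 0 := (zero_lt_one.trans_le hp).ne'
    have hpos : 0 < p.toReal := ENNReal.toReal_pos hp0 h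
    rw [XNorm, if_neg h, lNorm_of_ne_top h, eLpNorm_eq_lintegral_rpow_enorm_toReal hp0 h,
      eLpNorm_eq_lintegral_rpow_enorm_toReal hp0 h]
    congr 1
    have hcv := lintegral_image_eq_lintegral_abs_deriv_mul (s := univ) (f := Real.exp)
      (f' := Real.exp) MeasurableSet.univ (fun x _ => (Real.hasDerivAt_exp x).hasDerivWithinAt)
      Real.exp_injective.injOn
      (fun x => ‖f x * ((x ^ (-(1 / p.toReal)) : ℝ) : ℂ)‖ₑ ^ p.toReal)
    rw [image_univ, Real.range_exp, Measure.restrict_univ] at hcv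
    rw [hcv]
    refine lintegral_congr fun u => ?_
    rw [enorm_mul, ENNReal.mul_rpow_of_nonneg _ _ hpos.le, mul_left_comm]
    -- The Jacobian `e^u` cancels the `p`-th power of the weight, which is `x⁻¹`.
    have e : ENNReal.ofReal |Real.exp u| *
        ‖((Real.exp u ^ (-(1 / p.toReal)) : ℝ) : ℂ)‖ₑ ^ p.toReal = 1 := by
      have h1 : ‖((Real.exp u ^ (-(1 / p.toReal)) : ℝ) : ℂ)‖ₑ =
          ENNReal.ofReal (Real.exp u ^ (-(1 / p.toReal))) := by
        rw [← ofReal_norm, Complex.norm_real, Real.norm_of_nonneg (by positivity)]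
      rw [h1, ENNReal.ofReal_rpow_of_nonneg (by positivity) hpos.le,
        ← ENNReal.ofReal_mul (by positivity), abs_of_pos (Real.exp_pos u),
        ← Real.rpow_mul (Real.exp_pos u).le]
      have : -(1 / p.toReal) * p.toReal = -1 := by field_simp
      rw [this, Real.rpow_neg_one, mul_inv_cancel₀ (Real.exp_pos u).ne']
      simp
    rw [e, mul_one]

end change

end

/-! ### The generator of translations and smooth representatives. -/

section

open scoped ENNReal Real Interval

/-- Measurability and finite norm, in the logarithmic variable. -/
def MemL (p : ℝ≥0∞) (G : ℝ → ℂ) : Prop := AEStronglyMeasurable G volume ∧ LNorm p G < ∞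

/-- `H` is the derivative of `G` in norm, that is, the generator of translations maps `G` to
`H`. -/
def IsGen (p : ℝ≥0∞) (G H : ℝ → ℂ) : Prop :=
  MemL p G ∧ MemL p H ∧
    Tendsto (fun t : ℝ => LNorm p (fun u => (G (u + t) - G u) / (t : ℂ) - H u)) (𝓝[≠] 0) (𝓝 0)

/-- Powers of the generator of translations. -/
def IsGenPow (p : ℝ≥0∞) : ℕ → (ℝ → ℂ) → (ℝ → ℂ) → Prop
  | 0, G, H => MemL p G ∧ MemL p H ∧ LEq p G H
  | k + 1, G, H => ∃ K : ℝ → ℂ, IsGenPow p k G K ∧ IsGen p K H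

section transfer

variable {p : ℝ≥0∞} {f g : ℝ → ℂ}

lemma memX_iff (hp : 1 ≤ p) : MemX p f ↔ MemL p (fun u => f (Real.exp u)) := by
  rw [MemX, MemL, xNorm_eq_lNorm hp, aestronglyMeasurable_comp_exp_iff]

lemma xEq_iff (hp : 1 ≤ p) (hf : AEStronglyMeasurable f (volume.restrict (Ioi (0 : ℝ))))
    (hg : AEStronglyMeasurable g (volume.restrict (Ioi (0 : ℝ)))) :
    XEq p f g ↔ LEq p (fun u => f (Real.exp u)) (fun u => g (Real.exp u)) := by
  rw [XEq, xNorm_eq_lNorm hp]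
  exact lNorm_sub_eq_zero_iff (zero_lt_one.trans_le hp).ne'
    (aestronglyMeasurable_comp_exp_iff.2 hf) (aestronglyMeasurable_comp_exp_iff.2 hg)

lemma isTheta_iff (hp : 1 ≤ p) :
    IsTheta p f g ↔ IsGen p (fun u => f (Real.exp u)) (fun u => g (Real.exp u)) := by
  rw [IsTheta, IsGen, memX_iff hp, memX_iff hp]
  simp only [xNorm_eq_lNorm hp, mellinShift, ← Real.exp_add]
  simp only [add_comm]

lemma isThetaPow_iff (hp : 1 ≤ p) (k : ℕ) :
    IsThetaPow p k f g ↔ IsGenPow p k (fun u => f (Real.exp u)) (fun u => g (Real.exp u)) := by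
  induction k generalizing g with
  | zero =>
    simp only [IsThetaPow, IsGenPow, memX_iff hp]
    refine and_congr_right fun hf => and_congr_right fun hg => xEq_iff hp ?_ ?_
    exacts [aestronglyMeasurable_comp_exp_iff.1 hf.1, aestronglyMeasurable_comp_exp_iff.1 hg.1]
  | succ k ih =>
    simp only [IsThetaPow, IsGenPow]
    constructor
    · rintro ⟨h, h1, h2⟩
      exact ⟨_, ih.1 h1, (isTheta_iff hp).1 h2⟩
    · rintro ⟨K, h1, h2⟩
      have e : (fun u => (fun x => K (Real.log x)) (Real.exp u)) = K := by
        ext u; simp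
      exact ⟨fun x => K (Real.log x), ih.2 (e.symm ▸ h1), (isTheta_iff hp).2 (e.symm ▸ h2)⟩

end transfer

section generator

variable {p : ℝ≥0∞} {G H K : ℝ → ℂ}

lemma MemL.locallyIntegrable (hp : 1 ≤ p) (hG : MemL p G) : LocallyIntegrable G volume :=
  MemLp.locallyIntegrable ⟨hG.1, (eLpNorm_le_lNorm p G).trans_lt hG.2⟩ hp

lemma MemL.intervalIntegrable (hp : 1 ≤ p) (hG : MemL p G) (a b : ℝ) :
    IntervalIntegrable G volume a b :=
  intervalIntegrable_iff.mpr
    (((hG.locallyIntegrable hp).integrableOn_isCompact isCompact_uIcc).mono_set uIoc_subset_uIcc)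

lemma enorm_intervalIntegral_le (G : ℝ → ℂ) (a b : ℝ) :
    ‖∫ u in a..b, G u‖ₑ ≤ ∫⁻ u in Ι a b, ‖G u‖ₑ := by
  rw [← ofReal_norm, intervalIntegral.norm_integral_eq_norm_integral_uIoc, ofReal_norm]
  exact enorm_integral_le_lintegral_enorm _

/-- Hölder's inequality. For `p = ∞` one has `p.toReal = 0` and `1 / 0 = 0`, so the exponent is `1`
and the bound is the supremum times the length. -/
lemma lintegral_uIoc_le (hp : 1 ≤ p) (hG : AEStronglyMeasurable G volume) (a b : ℝ) :
    ∫⁻ u in Ι a b, ‖G u‖ₑ ≤ LNorm p G * volume (Ι a b) ^ (1 - 1 / p.toReal) := by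
  have h := eLpNorm_le_eLpNorm_mul_rpow_measure_univ hp (hG.restrict (s := Ι a b))
  rw [eLpNorm_one_eq_lintegral_enorm, Measure.restrict_apply_univ] at h
  refine h.trans ?_
  simp only [ENNReal.toReal_one, div_one]
  gcongr
  exact (eLpNorm_mono_measure _ Measure.restrict_le_self).trans (eLpNorm_le_lNorm p G)

lemma IsGen.tendsto_integral (hp : 1 ≤ p) (h : IsGen p G H) (a b : ℝ) :
    Tendsto (fun t : ℝ => ∫ u in a..b, ((G (u + t) - G u) / (t : ℂ) - H u)) (𝓝[≠] 0) (𝓝 0) := by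
  rw [tendsto_zero_iff_enorm_tendsto_zero]
  have hfin : volume (Ι a b) ^ (1 - 1 / p.toReal) ≠ ∞ := by
    refine ENNReal.rpow_ne_top_of_nonneg ?_ (by simp)
    rcases eq_or_ne p ∞ with rfl | hp'
    · simp
    · have : 1 ≤ p.toReal := by
        rw [← ENNReal.toReal_one]
        exact (ENNReal.toReal_le_toReal ENNReal.one_ne_top hp').2 hp
      rw [sub_nonneg]
      exact div_le_one_of_le₀ this (by linarith)
  have hlim := ENNReal.Tendsto.mul_const h.2.2 (b := volume (Ι a b) ^ (1 - 1 / p.toReal))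
    (Or.inr hfin)
  rw [zero_mul] at hlim
  refine tendsto_of_tendsto_of_tendsto_of_le_of_le tendsto_const_nhds hlim (fun _ => zero_le)
    fun t => ?_
  have hm : AEStronglyMeasurable (fun u => (G (u + t) - G u) / (t : ℂ) - H u) volume :=
    (((AEStronglyMeasurable.translate h.1.1 t).sub h.1.1).mul_const ((t : ℂ)⁻¹)).sub h.2.1.1
  refine le_trans ?_ (lintegral_uIoc_le hp hm a b)
  exact enorm_intervalIntegral_le _ a b

/-- Integrated over `[a, b]`, the difference quotient telescopes to a difference of averages of `G`
near `b` and near `a`. These tend to `G b - G a` wherever the primitive of `G` has derivative `G`;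
one such `a` fixes `c`, and almost every `b` qualifies. -/
lemma IsGen.ae_eq_integral (hp : 1 ≤ p) (h : IsGen p G H) :
    ∃ c, G =ᵐ[volume] fun u => c + ∫ y in (0 : ℝ)..u, H y := by
  have hae := LocallyIntegrable.ae_hasDerivAt_integral (h.1.locallyIntegrable hp)
  obtain ⟨a, ha⟩ := hae.exists
  have hGi := h.1.intervalIntegrable hp
  have hHi := h.2.1.intervalIntegrable hp
  refine ⟨G a - ∫ y in (0 : ℝ)..a, H y, hae.mono fun b hb => ?_⟩
  have h1 := (hb 0).tendsto_slope_zero.sub (ha 0).tendsto_slope_zero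
  have h2 := (h.tendsto_integral hp a b).add_const (∫ y in a..b, H y)
  rw [zero_add] at h2
  have key : G b - G a = ∫ y in a..b, H y := by
    refine tendsto_nhds_unique h1 (h2.congr' ?_)
    filter_upwards [self_mem_nhdsWithin] with t ht
    have ht' : (t : ℂ) ≠ 0 := by exact_mod_cast ht
    have hGt : IntervalIntegrable (fun u => G (u + t)) volume a b := by
      have := (hGi (a + t) (b + t)).comp_add_right t
      simpa using this
    rw [intervalIntegral.integral_sub ((hGt.sub (hGi a b)).div_const _) (hHi a b),
      intervalIntegral.integral_div, intervalIntegral.integral_sub hGt (hGi a b),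
      intervalIntegral.integral_comp_add_right (fun u => G u) t, sub_add_cancel]
    rw [← intervalIntegral.integral_interval_sub_left (hGi 0 (b + t)) (hGi 0 (a + t)),
      ← intervalIntegral.integral_interval_sub_left (hGi 0 b) (hGi 0 a)]
    simp only [Complex.real_smul, Complex.ofReal_inv]
    field_simp
    ring
  have h3 := intervalIntegral.integral_interval_sub_left (hHi 0 b) (hHi 0 a)
  rw [← h3] at key
  linear_combination key

/-- Convergence in the supremum norm is convergence at every point. For `p = ∞` this makes `G`
continuous and upgrades the integral formula from almost everywhere to everywhere. -/
lemma IsGen.hasDerivAt (h : IsGen ∞ G H) (u : ℝ) : HasDerivAt G (H u) u := by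
  rw [hasDerivAt_iff_tendsto_slope_zero, tendsto_iff_norm_sub_tendsto_zero,
    ← tendsto_zero_iff_norm_tendsto_zero, tendsto_zero_iff_enorm_tendsto_zero]
  refine tendsto_of_tendsto_of_tendsto_of_le_of_le tendsto_const_nhds h.2.2 (fun _ => zero_le)
    fun t => ?_
  simp only [lNorm_top]
  refine le_trans (le_of_eq ?_)
    (le_iSup (fun u => ‖(G (u + t) - G u) / (t : ℂ) - H u‖ₑ) u)
  simp only [Complex.real_smul, Complex.ofReal_inv]
  rw [div_eq_inv_mul]

/-- A function in the domain of the generator is an integral of its image. -/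
lemma IsGen.lEq_integral (hp : 1 ≤ p) (h : IsGen p G H) :
    ∃ c, LEq p G fun u => c + ∫ y in (0 : ℝ)..u, H y := by
  obtain ⟨c, hc⟩ := h.ae_eq_integral hp
  refine ⟨c, fun hp' => ?_, hc⟩
  subst hp'
  have hG : Continuous G := continuous_iff_continuousAt.2 fun u => (h.hasDerivAt u).continuousAt
  have hI : Continuous fun u => c + ∫ y in (0 : ℝ)..u, H y :=
    continuous_const.add (intervalIntegral.continuous_primitive (h.2.1.intervalIntegrable hp) 0)
  exact (hG.ae_eq_iff_eq volume hI).1 hc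

lemma IsGen.unique (hp : 1 ≤ p) {G' H' : ℝ → ℂ} (h : IsGen p G H) (h' : IsGen p G' H')
    (hG : LEq p G G') : LEq p H H' := by
  rw [← lNorm_sub_eq_zero_iff (zero_lt_one.trans_le hp).ne' h.2.1.1 h'.2.1.1]
  have hlim := h.2.2.add h'.2.2
  rw [add_zero] at hlim
  refine le_antisymm (ge_of_tendsto hlim (Eventually.of_forall fun t => ?_)) zero_le
  have hm : AEStronglyMeasurable (fun u => (G (u + t) - G u) / (t : ℂ)) volume :=
    ((AEStronglyMeasurable.translate h.1.1 t).sub h.1.1).mul_const ((t : ℂ)⁻¹)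
  have e : LEq p (fun u => (G' (u + t) - G' u) / (t : ℂ) - H' u)
      (fun u => (G (u + t) - G u) / (t : ℂ) - H' u) := by
    have := ((hG.symm.translate t).sub hG.symm).const_mul ((t : ℂ)⁻¹)
    simp only [← div_eq_inv_mul] at this
    exact this.sub (LEq.refl p H')
  rw [e.lNorm_eq, lNorm_sub_comm (p := p) _ H]
  refine le_trans (le_of_eq ?_) (lNorm_add_le hp (h.2.1.1.sub hm) (hm.sub h'.2.1.1))
  congr 1
  ext u
  simp

lemma IsGenPow.unique (hp : 1 ≤ p) {k : ℕ} (h : IsGenPow p k G H) (h' : IsGenPow p k G K) :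
    LEq p H K := by
  induction k generalizing H K with
  | zero => exact h.2.2.symm.trans h'.2.2
  | succ k ih =>
    obtain ⟨H₁, h1, h2⟩ := h
    obtain ⟨K₁, h1', h2'⟩ := h'
    exact h2.unique hp h2' (ih h1 h1')

lemma IsGenPow.memL {k : ℕ} (h : IsGenPow p k G H) : MemL p H := by
  cases k with
  | zero => exact h.2.1
  | succ k =>
    obtain ⟨_, _, h2⟩ := h
    exact h2.2.1

/-- Regularity climbs down the powers: a continuous representative of the image under power `k + 1`
integrates to a `C¹` representative of the image under power `k`, and so on down to `G`. -/
lemma IsGenPow.exists_contDiff (hp : 1 ≤ p) {k : ℕ} (h : IsGenPow p k G H) (hK : Continuous K)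
    (hHK : LEq p H K) : ∃ F, ContDiff ℝ k F ∧ LEq p G F ∧ iteratedDeriv k F = K := by
  induction k generalizing H K with
  | zero => exact ⟨K, by simpa using hK, h.2.2.trans hHK, iteratedDeriv_zero⟩
  | succ k ih =>
    obtain ⟨H₁, h1, h2⟩ := h
    obtain ⟨c, hc⟩ := h2.lEq_integral hp
    have e : ∀ u, ∫ y in (0 : ℝ)..u, H y = ∫ y in (0 : ℝ)..u, K y := fun u =>
      intervalIntegral.integral_congr_ae (hHK.2.mono fun y hy _ => hy)
    simp only [e] at hc
    have hd : ∀ u, HasDerivAt (fun u => c + ∫ y in (0 : ℝ)..u, K y) (K u) u := fun u =>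
      (hK.integral_hasStrictDerivAt 0 u).hasDerivAt.const_add c
    obtain ⟨F, hF, hGF, hFk⟩ := ih h1
      (continuous_iff_continuousAt.2 fun u => (hd u).continuousAt) hc
    have hk : iteratedDeriv (k + 1) F = K := by
      ext u
      rw [iteratedDeriv_succ, hFk, (hd u).deriv]
    refine ⟨F, ?_, hGF, hk⟩
    rw [contDiff_nat_iff_iteratedDeriv] at hF ⊢
    refine ⟨fun m hm => ?_, fun m hm => ?_⟩
    · rcases hm.lt_or_eq with hlt | rfl
      · exact hF.1 m (Nat.lt_succ_iff.1 hlt)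
      · rwa [hk]
    · rcases (Nat.lt_succ_iff.1 hm).lt_or_eq with hlt | rfl
      · exact hF.2 m hlt
      · rw [hFk]
        exact fun u => (hd u).differentiableAt

/-- A function in the domain of every power of the generator has a smooth representative whose
derivatives represent the images under the powers of the generator. -/
lemma exists_smooth_representative (hp : 1 ≤ p) (h : ∀ k, ∃ H, IsGenPow p k G H) :
    ∃ F, ContDiff ℝ (⊤ : ℕ∞) F ∧ LEq p G F ∧
      ∀ k H, IsGenPow p k G H → LEq p H (iteratedDeriv k F) := by
  have key : ∀ k : ℕ, ∃ F H, ContDiff ℝ k F ∧ LEq p G F ∧ IsGenPow p k G H ∧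
      LEq p H (iteratedDeriv k F) := by
    intro k
    -- One power more than needed: it exhibits the `k`-th image as an integral, hence as continuous
    -- up to `LEq`.
    obtain ⟨H', H, h1, h2⟩ := h (k + 1)
    obtain ⟨c, hc⟩ := h2.lEq_integral hp
    have hI : Continuous fun u => c + ∫ y in (0 : ℝ)..u, H' y :=
      continuous_const.add (intervalIntegral.continuous_primitive (h2.2.1.intervalIntegrable hp) 0)
    obtain ⟨F, hF, hGF, hk⟩ := h1.exists_contDiff hp hI hc
    exact ⟨F, H, hF, hGF, h1, hk ▸ hc⟩
  choose F H hF hGF hH hHF using key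
  -- The representatives for different `k` are continuous and agree almost everywhere, so they are
  -- one function.
  have hFF : ∀ k, F k = F 0 := fun k =>
    ((hGF k).symm.trans (hGF 0)).eq_of_continuous (hF k).continuous (hF 0).continuous
  refine ⟨F 0, contDiff_infty.2 fun k => hFF k ▸ hF k, hGF 0, fun k K hK => ?_⟩
  rw [← hFF k]
  exact (hK.unique hp (hH k)).trans (hHF k)

/-- A supremum bound in terms of the norms of a function and its derivative. -/
lemma enorm_le_lNorm_add_lNorm_deriv (hp : 1 ≤ p) {F : ℝ → ℂ} (hF : ContDiff ℝ 1 F) (u : ℝ) :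
    ‖F u‖ₑ ≤ LNorm p F + LNorm p (deriv F) := by
  have hF' : Continuous (deriv F) := hF.continuous_deriv le_rfl
  have hvol : volume (Ι u (u + 1)) = 1 := by
    rw [uIoc_of_le (by linarith)]
    simp
  have hb : ∀ K : ℝ → ℂ, Continuous K → ∫⁻ v in Ι u (u + 1), ‖K v‖ₑ ≤ LNorm p K := fun K hK => by
    simpa [hvol] using lintegral_uIoc_le hp hK.aestronglyMeasurable u (u + 1)
  -- `F u` is compared with `F v` and averaged over an interval of length one, where the Hölder
  -- factor is `1` for every `p`.
  have hpt : ∀ v ∈ Ι u (u + 1), ‖F u‖ₑ ≤ ‖F v‖ₑ + LNorm p (deriv F) := by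
    intro v hv
    have hint : ∫ y in u..v, deriv F y = F v - F u :=
      intervalIntegral.integral_deriv_eq_sub
        (fun y _ => (hF.differentiable one_ne_zero) y) (hF'.intervalIntegrable _ _)
    have e : F u = F v - ∫ y in u..v, deriv F y := by rw [hint]; ring
    rw [uIoc_of_le (by linarith)] at hv
    calc ‖F u‖ₑ = ‖F v - ∫ y in u..v, deriv F y‖ₑ := by rw [← e]
      _ ≤ ‖F v‖ₑ + ‖∫ y in u..v, deriv F y‖ₑ := enorm_sub_le
      _ ≤ ‖F v‖ₑ + LNorm p (deriv F) := by
        gcongr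
        refine (enorm_intervalIntegral_le _ u v).trans (le_trans ?_ (hb _ hF'))
        refine lintegral_mono_set ?_
        rw [uIoc_of_le hv.1.le, uIoc_of_le (by linarith)]
        exact Ioc_subset_Ioc_right hv.2
  have h1 : ∫⁻ _ in Ι u (u + 1), ‖F u‖ₑ ≤ ∫⁻ v in Ι u (u + 1), (‖F v‖ₑ + LNorm p (deriv F)) :=
    setLIntegral_mono' measurableSet_uIoc hpt
  rw [lintegral_add_right _ measurable_const, setLIntegral_const, setLIntegral_const, hvol, mul_one,
    mul_one] at h1
  exact h1.trans (add_le_add_left (hb F hF.continuous) _)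

end generator

end

/-! ### Bernstein functions: Taylor expansion, powers of the generator, norm convergence. -/

section

open scoped ENNReal Real Interval Nat

/-- `F` is a smooth representative of `G` that obeys Bernstein's inequalities of type `σ` in the
norm of exponent `p` and in the supremum norm. -/
structure BernsteinRep (σ : ℝ) (p : ℝ≥0∞) (G F : ℝ → ℂ) : Prop where
  smooth : ContDiff ℝ (⊤ : ℕ∞) F
  lEq : LEq p G F
  lNorm_le : ∀ k, LNorm p (iteratedDeriv k F) ≤ ENNReal.ofReal (σ ^ k) * LNorm p F
  bounded : ∃ C, ∀ k u, ‖iteratedDeriv k F u‖ ≤ C * σ ^ k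

/-- The Bernstein space in the logarithmic variable. -/
def MemLBernstein (σ : ℝ) (p : ℝ≥0∞) (G : ℝ → ℂ) : Prop :=
  ∀ k, ∃ H, IsGenPow p k G H ∧ LNorm p H ≤ ENNReal.ofReal (σ ^ k) * LNorm p G

variable {p : ℝ≥0∞} {σ : ℝ} {F G H : ℝ → ℂ}

lemma MemL.congr (hG : MemL p G) (h : LEq p G H) : MemL p H :=
  ⟨hG.1.congr h.2, h.lNorm_eq ▸ hG.2⟩

lemma MemLBernstein.exists_rep (hp : 1 ≤ p) (hσ : 0 < σ) (hG : MemL p G)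
    (h : MemLBernstein σ p G) : ∃ F, BernsteinRep σ p G F := by
  obtain ⟨F, hF, hGF, hFk⟩ := exists_smooth_representative hp fun k => (h k).imp fun _ h => h.1
  have hle : ∀ k, LNorm p (iteratedDeriv k F) ≤ ENNReal.ofReal (σ ^ k) * LNorm p G := fun k => by
    obtain ⟨H, h1, h2⟩ := h k
    rwa [← (hFk k H h1).lNorm_eq]
  -- The factor `1 + σ` collects `σ ^ k` and `σ ^ (k + 1)` from the derivatives of orders `k` and `k
  -- + 1`.
  refine ⟨F, hF, hGF, fun k => hGF.lNorm_eq ▸ hle k, (1 + σ) * (LNorm p G).toReal, fun k u => ?_⟩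
  have h1 := enorm_le_lNorm_add_lNorm_deriv hp (F := iteratedDeriv k F)
    ((contDiff_nat_succ_iff_contDiff_one_iteratedDeriv.1
      (hF.of_le (by exact_mod_cast le_top))).2) u
  rw [← iteratedDeriv_succ] at h1
  have h2 := h1.trans (add_le_add (hle k) (hle (k + 1)))
  rw [← ENNReal.ofReal_toReal hG.2.ne, ← ENNReal.ofReal_mul (by positivity),
    ← ENNReal.ofReal_mul (by positivity), ← ENNReal.ofReal_add (by positivity) (by positivity),
    ← ofReal_norm, ENNReal.ofReal_le_ofReal_iff (by positivity)] at h2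
  refine h2.trans (le_of_eq ?_)
  ring

/-- Taylor expansion of a function of exponential type. -/
lemma hasSum_taylor {E : ℝ → ℂ} (hE : ContDiff ℝ (⊤ : ℕ∞) E) {C : ℝ}
    (hC : ∀ k u, ‖iteratedDeriv k E u‖ ≤ C * σ ^ k) (u t : ℝ) :
    HasSum (fun j : ℕ => (t : ℂ) ^ j / (j ! : ℂ) * iteratedDeriv j E u) (E (u + t)) := by
  have hcd : ContDiff ℝ (⊤ : ℕ∞) (fun z => E (u + z)) := hE.comp (contDiff_const.add contDiff_id)
  have hd : ∀ k, iteratedDeriv k (fun s => E (u + t * s)) =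
      fun s => t ^ k • iteratedDeriv k E (u + t * s) := by
    intro k
    have := iteratedDeriv_comp_const_smul (n := k) (hcd.of_le (by exact_mod_cast le_top)) t
    rw [iteratedDeriv_comp_const_add] at this
    exact this
  -- Taylor's theorem is applied on `[0, 1]` along the segment from `u` to `u + t`, so the sign of
  -- `t` plays no role.
  set h : ℝ → ℂ := fun s => E (u + t * s) with hh
  have hhc : ContDiff ℝ (⊤ : ℕ∞) h := hcd.comp (contDiff_const.mul contDiff_id)
  have hw : ∀ k, ∀ s ∈ Icc (0 : ℝ) 1, iteratedDerivWithin k h (Icc 0 1) s = iteratedDeriv k h s :=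
    fun k s hs => iteratedDerivWithin_eq_iteratedDeriv (uniqueDiffOn_Icc one_pos)
      (hhc.contDiffAt.of_le (by exact_mod_cast le_top)) hs
  have hb : ∀ k s, ‖iteratedDeriv k h s‖ ≤ C * (|t| * σ) ^ k := fun k s => by
    rw [hd]
    simp only [norm_smul, norm_pow, Real.norm_eq_abs, mul_pow]
    calc |t| ^ k * ‖iteratedDeriv k E (u + t * s)‖ ≤ |t| ^ k * (C * σ ^ k) := by
          gcongr; exact hC k _
      _ = _ := by ring
  have hsum : Summable (fun j : ℕ => (t : ℂ) ^ j / (j ! : ℂ) * iteratedDeriv j E u) := by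
    refine Summable.of_norm_bounded ((Real.summable_pow_div_factorial (|t| * σ)).mul_left C)
      fun j => ?_
    rw [norm_mul, norm_div, norm_pow, Complex.norm_real, Complex.norm_natCast, Real.norm_eq_abs]
    calc |t| ^ j / (j ! : ℝ) * ‖iteratedDeriv j E u‖ ≤ |t| ^ j / (j ! : ℝ) * (C * σ ^ j) := by
          gcongr; exact hC j u
      _ = _ := by rw [mul_pow]; ring
  rw [hsum.hasSum_iff_tendsto_nat, ← tendsto_add_atTop_iff_nat 1]
  have hT : ∀ n, ∑ j ∈ Finset.range (n + 1), (t : ℂ) ^ j / (j ! : ℂ) * iteratedDeriv j E u =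
      taylorWithinEval h n (Icc 0 1) 0 1 := by
    intro n
    rw [taylor_within_apply]
    refine Finset.sum_congr rfl fun j _ => ?_
    rw [hw j 0 ⟨le_rfl, zero_le_one⟩, hd]
    simp only [mul_zero, add_zero, sub_zero, one_pow, mul_one, Complex.real_smul]
    push_cast
    field_simp
  rw [tendsto_iff_norm_sub_tendsto_zero]
  have hz : Tendsto (fun n : ℕ => C * (|t| * σ) * ((|t| * σ) ^ n / (n ! : ℝ))) atTop (𝓝 0) := by
    simpa using (FloorSemiring.tendsto_pow_div_factorial_atTop (|t| * σ)).const_mul (C * (|t| * σ))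
  refine squeeze_zero (fun _ => norm_nonneg _) (fun n => ?_) hz
  rw [hT, norm_sub_rev]
  have := taylor_mean_remainder_bound (f := h) (a := 0) (b := 1) (x := 1) (n := n)
    (C := C * (|t| * σ) ^ (n + 1)) zero_le_one
    ((hhc.of_le (by exact_mod_cast le_top)).contDiffOn) ⟨zero_le_one, le_rfl⟩
    (fun y hy => by rw [hw _ y hy]; exact hb _ y)
  have e1 : h 1 = E (u + t) := by simp [hh]
  rw [e1] at this
  refine this.trans (le_of_eq ?_)
  rw [pow_succ]
  ring

/-- By Taylor expansion the difference quotient minus the derivative is `∑ t^(j+1) E^(j+2) /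
(j+2)!`, of norm at most `|t| σ² e^σ N` for `|t| ≤ 1`. -/
lemma isGen_deriv (hp : 1 ≤ p) (hσ : 0 < σ) {E : ℝ → ℂ} (hE : ContDiff ℝ (⊤ : ℕ∞) E) {C : ℝ}
    (hC : ∀ k u, ‖iteratedDeriv k E u‖ ≤ C * σ ^ k) {N : ℝ≥0∞} (hN : N < ∞)
    (hL : ∀ k, LNorm p (iteratedDeriv k E) ≤ ENNReal.ofReal (σ ^ k) * N) :
    IsGen p E (deriv E) := by
  have hcont : ∀ k, Continuous (iteratedDeriv k E) := fun k =>
    hE.continuous_iteratedDeriv k (by exact_mod_cast le_top)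
  have hmem : ∀ k, MemL p (iteratedDeriv k E) := fun k =>
    ⟨(hcont k).aestronglyMeasurable, (hL k).trans_lt (ENNReal.mul_lt_top ENNReal.ofReal_lt_top hN)⟩
  refine ⟨by simpa using hmem 0, by simpa [iteratedDeriv_one] using hmem 1, ?_⟩
  set A : ℝ≥0∞ := (∑' j : ℕ, ENNReal.ofReal (σ ^ 2 * (σ ^ j / (j ! : ℝ)))) * N with hA
  have hAfin : A ≠ ∞ := by
    refine (ENNReal.mul_lt_top ?_ hN).ne
    exact ((Real.summable_pow_div_factorial σ).mul_left (σ ^ 2)).tsum_ofReal_lt_top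
  have hlim : Tendsto (fun t : ℝ => ENNReal.ofReal |t| * A) (𝓝[≠] 0) (𝓝 0) := by
    have h0 : Tendsto (fun t : ℝ => ENNReal.ofReal |t|) (𝓝[≠] 0) (𝓝 0) := by
      have : Tendsto (fun t : ℝ => ENNReal.ofReal |t|) (𝓝 0) (𝓝 (ENNReal.ofReal |0|)) :=
        (ENNReal.continuous_ofReal.comp continuous_abs).tendsto 0
      simpa using this.mono_left nhdsWithin_le_nhds
    simpa using ENNReal.Tendsto.mul_const h0 (Or.inr hAfin)
  refine tendsto_of_tendsto_of_tendsto_of_le_of_le' tendsto_const_nhds hlim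
    (Eventually.of_forall fun _ => zero_le) ?_
  have hI : Icc (-1 : ℝ) 1 ∈ 𝓝[≠] (0 : ℝ) :=
    mem_nhdsWithin_of_mem_nhds (Icc_mem_nhds (by norm_num) (by norm_num))
  filter_upwards [hI, self_mem_nhdsWithin] with t ht ht0
  have ht1 : |t| ≤ 1 := abs_le.2 ht
  have ht0' : (t : ℂ) ≠ 0 := by exact_mod_cast ht0
  have hs : ∀ u, HasSum (fun j : ℕ => (t : ℂ)⁻¹ * ((t : ℂ) ^ (j + 2) / ((j + 2)! : ℂ)) *
      iteratedDeriv (j + 2) E u) ((E (u + t) - E u) / (t : ℂ) - deriv E u) := by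
    intro u
    have h1 := (hasSum_nat_add_iff' 2).2 (hasSum_taylor hE hC u t)
    have h2 := h1.mul_left ((t : ℂ)⁻¹)
    convert! h2 using 1
    · ext j
      ring
    · simp [Finset.sum_range_succ, iteratedDeriv_one]
      field_simp
      ring
  refine (lNorm_le_tsum hp (fun j => ((hcont _).aestronglyMeasurable.const_mul _)) hs).trans ?_
  rw [hA, ← mul_assoc, ← ENNReal.tsum_mul_left, ← ENNReal.tsum_mul_right]
  refine ENNReal.tsum_le_tsum fun j => ?_
  rw [lNorm_const_mul]
  refine (mul_le_mul_right (hL (j + 2)) _).trans ?_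
  rw [← mul_assoc]
  refine mul_le_mul' ?_ le_rfl
  rw [← ofReal_norm, ← ENNReal.ofReal_mul (norm_nonneg _), ← ENNReal.ofReal_mul (abs_nonneg _)]
  refine ENNReal.ofReal_le_ofReal ?_
  rw [norm_mul, norm_inv, norm_div, norm_pow, Complex.norm_real, Complex.norm_natCast,
    Real.norm_eq_abs]
  have htpos : 0 < |t| := abs_pos.2 ht0
  have e : |t|⁻¹ * (|t| ^ (j + 2) / ((j + 2)! : ℝ)) * σ ^ (j + 2) =
      |t| * (σ ^ 2 * (σ ^ j * (|t| ^ j / ((j + 2)! : ℝ)))) := by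
    field_simp
    ring
  rw [e, div_eq_mul_inv (σ ^ j)]
  gcongr
  rw [← one_div]
  gcongr
  · exact pow_le_one₀ (abs_nonneg _) ht1
  · omega

lemma BernsteinRep.isGenPow (hp : 1 ≤ p) (hσ : 0 < σ) (hG : MemL p G) (h : BernsteinRep σ p G F)
    (k : ℕ) : IsGenPow p k G (iteratedDeriv k F) := by
  obtain ⟨C, hC⟩ := h.bounded
  have hF : MemL p F := hG.congr h.lEq
  induction k with
  | zero => exact ⟨hG, by simpa using hF, by simpa using h.lEq⟩
  | succ k ih =>
    refine ⟨_, ih, ?_⟩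
    rw [iteratedDeriv_succ]
    have e : ∀ j, iteratedDeriv j (iteratedDeriv k F) = iteratedDeriv (k + j) F := fun j => by
      simp only [iteratedDeriv_eq_iterate]
      rw [← Function.iterate_add_apply, add_comm]
    refine isGen_deriv hp hσ (C := C * σ ^ k) (N := ENNReal.ofReal (σ ^ k) * LNorm p F) ?_
      (fun j u => ?_) (ENNReal.mul_lt_top ENNReal.ofReal_lt_top hF.2) fun j => ?_
    · rw [iteratedDeriv_eq_iterate]
      exact h.smooth.iterate_deriv k
    · rw [e]
      refine (hC (k + j) u).trans (le_of_eq ?_)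
      rw [pow_add]; ring
    · rw [e, ← mul_assoc, ← ENNReal.ofReal_mul (by positivity), ← pow_add, add_comm j k]
      exact h.lNorm_le _

lemma BernsteinRep.memLBernstein (hp : 1 ≤ p) (hσ : 0 < σ) (hG : MemL p G)
    (h : BernsteinRep σ p G F) : MemLBernstein σ p G := fun k =>
  ⟨_, h.isGenPow hp hσ hG k, by rw [h.lEq.lNorm_eq]; exact h.lNorm_le k⟩

/-- Norm convergence of the Riesz-Boas series of a bounded continuous function. -/
lemma tendsto_lNorm_rb (hp : 1 ≤ p) (r : ℕ) (hF : Continuous F) (hFL : LNorm p F < ∞)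
    (hs : ∀ u, HasSum (fun k => (rbCoeff σ r k : ℂ) * F (u + rbNode σ r k)) (H u)) :
    Tendsto (fun s : Finset ℤ => LNorm p
      (fun u => (∑ k ∈ s, (rbCoeff σ r k : ℂ) * F (u + rbNode σ r k)) - H u)) atTop (𝓝 0) := by
  refine tendsto_lNorm_sum_sub hp
    (fun k => Continuous.aestronglyMeasurable (by fun_prop)) hs ?_
  simp only [lNorm_const_mul, lNorm_translate hF.aestronglyMeasurable]
  rw [ENNReal.tsum_mul_right]
  refine (ENNReal.mul_lt_top ?_ hFL).ne
  have e : ∀ k, ‖(rbCoeff σ r k : ℂ)‖ₑ = ENNReal.ofReal |rbCoeff σ r k| := fun k => by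
    rw [← ofReal_norm, Complex.norm_real, Real.norm_eq_abs]
  simp only [e]
  exact (summable_rbCoeff σ r).tsum_ofReal_lt_top

lemma lEq_rb_sum (h : LEq p G F) (r : ℕ) (s : Finset ℤ) :
    LEq p (fun u => ∑ k ∈ s, (rbCoeff σ r k : ℂ) * G (u + rbNode σ r k))
      (fun u => ∑ k ∈ s, (rbCoeff σ r k : ℂ) * F (u + rbNode σ r k)) :=
  LEq.sum fun k => (h.translate (rbNode σ r k)).const_mul _

lemma BernsteinRep.tendsto_rb (hp : 1 ≤ p) (hσ : 0 < σ) (hG : MemL p G)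
    (h : BernsteinRep σ p G F) (r : ℕ) :
    Tendsto (fun s : Finset ℤ => LNorm p (fun u =>
      (∑ k ∈ s, (rbCoeff σ r k : ℂ) * G (u + rbNode σ r k)) - iteratedDeriv r F u))
      atTop (𝓝 0) := by
  obtain ⟨C, hC⟩ := h.bounded
  have := tendsto_lNorm_rb hp r h.smooth.continuous (hG.congr h.lEq).2
    (hasSum_rbCoeff h.smooth hσ hC r)
  refine this.congr fun s => ?_
  exact ((lEq_rb_sum h.lEq r s).sub (LEq.refl p _)).lNorm_eq.symm

end

/-! ### From the first order formula back to Bernstein's inequalities. -/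

section

open scoped ENNReal Real Interval Nat

variable {p : ℝ≥0∞} {σ : ℝ} {F G H : ℝ → ℂ}

/-- The Riesz-Boas series of first order is bounded by `σ` in norm. -/
lemma lNorm_le_of_hasSum_rb_one (hp : 1 ≤ p) (hσ : 0 < σ) (hF : Continuous F)
    (hs : ∀ u, HasSum (fun k => (rbCoeff σ 1 k : ℂ) * F (u + rbNode σ 1 k)) (H u)) :
    LNorm p H ≤ ENNReal.ofReal σ * LNorm p F := by
  refine (lNorm_le_tsum hp (fun k => Continuous.aestronglyMeasurable (by fun_prop)) hs).trans ?_
  simp only [lNorm_const_mul, lNorm_translate hF.aestronglyMeasurable]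
  rw [ENNReal.tsum_mul_right]
  have e : ∀ k, ‖(rbCoeff σ 1 k : ℂ)‖ₑ = ENNReal.ofReal |rbCoeff σ 1 k| := fun k => by
    rw [← ofReal_norm, Complex.norm_real, Real.norm_eq_abs]
  simp only [e]
  rw [← ENNReal.ofReal_tsum_of_nonneg (fun _ => abs_nonneg _) (summable_rbCoeff σ 1),
    tsum_abs_rbCoeff_one hσ]

lemma norm_le_of_hasSum_rb_one (hσ : 0 < σ) {C : ℝ} (hC : ∀ u, ‖F u‖ ≤ C)
    (hs : ∀ u, HasSum (fun k => (rbCoeff σ 1 k : ℂ) * F (u + rbNode σ 1 k)) (H u)) (u : ℝ) :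
    ‖H u‖ ≤ C * σ := by
  rw [← (hs u).tsum_eq]
  have hb : HasSum (fun k => C * |rbCoeff σ 1 k|) (C * σ) := by
    have := (summable_rbCoeff σ 1).hasSum.mul_left C
    rwa [tsum_abs_rbCoeff_one hσ] at this
  refine tsum_of_norm_bounded hb fun k => ?_
  rw [norm_mul, Complex.norm_real, Real.norm_eq_abs, mul_comm]
  gcongr
  exact hC _

/-- Termwise differentiation of the first order Riesz-Boas series. -/
lemma hasDerivAt_of_hasSum_rb (hF : ∀ u, HasDerivAt F (H u) u) {D : ℝ}
    (hD : ∀ u, ‖H u‖ ≤ D) (hH : Continuous H)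
    (hs : ∀ u, HasSum (fun k => (rbCoeff σ 1 k : ℂ) * F (u + rbNode σ 1 k)) (H u)) :
    ∃ K : ℝ → ℂ, Continuous K ∧ (∀ u, HasDerivAt H (K u) u) ∧
      ∀ u, HasSum (fun k => (rbCoeff σ 1 k : ℂ) * H (u + rbNode σ 1 k)) (K u) := by
  have hsum : Summable (fun k => |rbCoeff σ 1 k| * D) := (summable_rbCoeff σ 1).mul_right D
  have hbd : ∀ k u, ‖(rbCoeff σ 1 k : ℂ) * H (u + rbNode σ 1 k)‖ ≤ |rbCoeff σ 1 k| * D := by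
    intro k u
    rw [norm_mul, Complex.norm_real, Real.norm_eq_abs]
    gcongr
    exact hD _
  refine ⟨fun u => ∑' k, (rbCoeff σ 1 k : ℂ) * H (u + rbNode σ 1 k),
    continuous_tsum (fun k => by fun_prop) hsum hbd, fun u => ?_,
    fun u => (Summable.of_norm_bounded hsum fun k => hbd k u).hasSum⟩
  have e : H = fun u => ∑' k, (rbCoeff σ 1 k : ℂ) * F (u + rbNode σ 1 k) := by
    ext u; exact (hs u).tsum_eq.symm
  have := hasDerivAt_tsum (𝕜 := ℝ) (y₀ := u) (y := u) hsum
    (g := fun k y => (rbCoeff σ 1 k : ℂ) * F (y + rbNode σ 1 k))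
    (g' := fun k y => (rbCoeff σ 1 k : ℂ) * H (y + rbNode σ 1 k))
    (fun k y => ((hF _).comp_add_const y (rbNode σ 1 k)).const_mul _) hbd (hs u).summable
  rw [← e] at this
  exact this

/-- A bounded function that satisfies the first order Riesz-Boas formula is its own Bernstein
representative. -/
lemma bernsteinRep_of_hasSum_rb_one (hp : 1 ≤ p) (hσ : 0 < σ) (hF : ContDiff ℝ 1 F) {C : ℝ}
    (hC : ∀ u, ‖F u‖ ≤ C)
    (hs : ∀ u, HasSum (fun k => (rbCoeff σ 1 k : ℂ) * F (u + rbNode σ 1 k)) (deriv F u))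
    (hGF : LEq p G F) : BernsteinRep σ p G F := by
  -- Bootstrap: the formula for `F^(n)` bounds `F^(n+1)` through `∑ |c_k| = σ`; that bound permits
  -- termwise differentiation, which yields one more derivative and the formula for `F^(n+1)`.
  have key : ∀ n : ℕ, ContDiff ℝ (n + 1 : ℕ) F ∧
      (∀ u, HasSum (fun k => (rbCoeff σ 1 k : ℂ) * iteratedDeriv n F (u + rbNode σ 1 k))
        (iteratedDeriv (n + 1) F u)) ∧
      (∀ u, ‖iteratedDeriv n F u‖ ≤ C * σ ^ n) ∧
      LNorm p (iteratedDeriv n F) ≤ ENNReal.ofReal (σ ^ n) * LNorm p F := by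
    intro n
    induction n with
    | zero => exact ⟨by simpa using hF, by simpa [iteratedDeriv_one] using hs, by simpa using hC,
        by simp⟩
    | succ n ih =>
      obtain ⟨h1, h2, h3, h4⟩ := ih
      have hc : Continuous (iteratedDeriv n F) :=
        h1.continuous_iteratedDeriv n (by exact_mod_cast Nat.le_succ n)
      have hc' : Continuous (iteratedDeriv (n + 1) F) := h1.continuous_iteratedDeriv _ le_rfl
      have hd : ∀ u, HasDerivAt (iteratedDeriv n F) (iteratedDeriv (n + 1) F u) u := fun u => by
        rw [iteratedDeriv_succ]
        exact (h1.differentiable_iteratedDeriv n (by exact_mod_cast Nat.lt_succ_self n)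
          u).hasDerivAt
      have hb := norm_le_of_hasSum_rb_one hσ h3 h2
      obtain ⟨K, hK, hK1, hK2⟩ := hasDerivAt_of_hasSum_rb hd hb hc' h2
      have hKe : K = iteratedDeriv (n + 1 + 1) F := by
        ext u
        rw [iteratedDeriv_succ (n := n + 1), (hK1 u).deriv]
      refine ⟨?_, hKe ▸ hK2, fun u => (hb u).trans (le_of_eq (by ring)), ?_⟩
      · rw [contDiff_nat_succ_iff_contDiff_one_iteratedDeriv, contDiff_one_iff_deriv]
        refine ⟨h1, fun u => (hK1 u).differentiableAt, ?_⟩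
        rw [← iteratedDeriv_succ, ← hKe]
        exact hK
      · refine (lNorm_le_of_hasSum_rb_one hp hσ hc h2).trans ?_
        rw [pow_succ, mul_comm (σ ^ n), ENNReal.ofReal_mul hσ.le, mul_assoc]
        gcongr
  exact ⟨contDiff_infty.2 fun n => (key n).1.of_le (by exact_mod_cast Nat.le_succ n), hGF,
    fun n => (key n).2.2.2, C, fun n => (key n).2.2.1⟩

/-- The operator identities for the powers of the generator imply the existence of a Bernstein
representative. -/
lemma exists_rep_of_tendsto_rb (hp : 1 ≤ p) (hσ : 0 < σ) (hG : MemL p G)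
    (h : ∀ r, 1 ≤ r → ∃ H, IsGenPow p r G H ∧ Tendsto (fun s : Finset ℤ => LNorm p (fun u =>
      (∑ k ∈ s, (rbCoeff σ r k : ℂ) * G (u + rbNode σ r k)) - H u)) atTop (𝓝 0)) :
    ∃ F, BernsteinRep σ p G F := by
  have hall : ∀ k, ∃ H, IsGenPow p k G H := by
    intro k
    rcases Nat.eq_zero_or_pos k with rfl | hk
    · exact ⟨G, hG, hG, LEq.refl p G⟩
    · exact (h k hk).imp fun _ h => h.1
  obtain ⟨F, hF, hGF, hFk⟩ := exists_smooth_representative hp hall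
  have hF1 : ContDiff ℝ 1 F := hF.of_le (by exact_mod_cast le_top)
  have hFL : MemL p F := hG.congr hGF
  -- From here on only order one is used; the higher orders served to put `G` in the domain of every
  -- power.
  obtain ⟨H, hH, hlim⟩ := h 1 le_rfl
  have hHF : LEq p H (deriv F) := by simpa [iteratedDeriv_one] using hFk 1 H hH
  have hF'L : MemL p (deriv F) := hH.memL.congr hHF
  have hb : ∀ u, ‖F u‖ ≤ (LNorm p F + LNorm p (deriv F)).toReal := fun u => by
    rw [← toReal_enorm]
    exact ENNReal.toReal_mono (ENNReal.add_lt_top.2 ⟨hFL.2, hF'L.2⟩).ne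
      (enorm_le_lNorm_add_lNorm_deriv hp hF1 u)
  have hsum := (summable_rbCoeff σ 1).mul_right (LNorm p F + LNorm p (deriv F)).toReal
  have hbd : ∀ k u, ‖(rbCoeff σ 1 k : ℂ) * F (u + rbNode σ 1 k)‖ ≤
      |rbCoeff σ 1 k| * (LNorm p F + LNorm p (deriv F)).toReal := by
    intro k u
    rw [norm_mul, Complex.norm_real, Real.norm_eq_abs]
    gcongr
    exact hb _
  set R : ℝ → ℂ := fun u => ∑' k, (rbCoeff σ 1 k : ℂ) * F (u + rbNode σ 1 k) with hR
  have hFc := hF.continuous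
  have hRc : Continuous R := continuous_tsum (fun k => by fun_prop) hsum hbd
  have hRs : ∀ u, HasSum (fun k => (rbCoeff σ 1 k : ℂ) * F (u + rbNode σ 1 k)) (R u) :=
    fun u => (Summable.of_norm_bounded hsum fun k => hbd k u).hasSum
  have hlim2 := tendsto_lNorm_rb hp 1 hFc hFL.2 hRs
  have hF'c : Continuous (deriv F) := hF1.continuous_deriv le_rfl
  -- Both are limits in norm of the same partial sums; being continuous, they then agree everywhere.
  have heq : LEq p (deriv F) R := by
    rw [← lNorm_sub_eq_zero_iff (zero_lt_one.trans_le hp).ne' hF'c.aestronglyMeasurable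
      hRc.aestronglyMeasurable]
    have hadd := hlim.add hlim2
    rw [add_zero] at hadd
    refine le_antisymm (ge_of_tendsto hadd (Eventually.of_forall fun s => ?_)) zero_le
    have hm : AEStronglyMeasurable
        (fun u => ∑ k ∈ s, (rbCoeff σ 1 k : ℂ) * F (u + rbNode σ 1 k)) volume :=
      Continuous.aestronglyMeasurable (by fun_prop)
    rw [((lEq_rb_sum hGF 1 s).sub hHF).lNorm_eq, lNorm_sub_comm (p := p) _ (deriv F)]
    refine le_trans (le_of_eq ?_) (lNorm_add_le hp (hF'c.aestronglyMeasurable.sub hm)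
      (hm.sub hRc.aestronglyMeasurable))
    congr 1
    ext u
    simp
  have hdR := heq.eq_of_continuous hF'c hRc
  exact ⟨F, bernsteinRep_of_hasSum_rb_one hp hσ hF1 hb (fun u => hdR ▸ hRs u) hGF⟩

/-- Lets a bound on a single term of the series become a bound on `F` in
`bernsteinRep_of_tendstoUniformly`. -/
lemma rbCoeff_one_ne_zero (hσ : 0 < σ) (k : ℤ) : rbCoeff σ 1 k ≠ 0 := by
  have hpi := Real.pi_pos
  have hk := half_sub_intCast_ne_zero k
  rw [rbCoeff, nodeCoeff_one]
  have h1 : (-1 : ℝ) ^ k ≠ 0 := zpow_ne_zero _ (by norm_num)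
  exact mul_ne_zero (by positivity) (mul_ne_zero (neg_ne_zero.2 h1) (by positivity))

/-- Uniform convergence of the first order Riesz-Boas series to the derivative implies the
Bernstein inequalities. -/
lemma bernsteinRep_of_tendstoUniformly (hp : 1 ≤ p) (hσ : 0 < σ) (hF : ContDiff ℝ 1 F)
    (hGF : LEq p G F)
    (hu : TendstoUniformly (fun (s : Finset ℤ) (u : ℝ) =>
      ∑ k ∈ s, (rbCoeff σ 1 k : ℂ) * F (u + rbNode σ 1 k)) (deriv F) atTop) :
    BernsteinRep σ p G F := by
  have hs : ∀ u, HasSum (fun k => (rbCoeff σ 1 k : ℂ) * F (u + rbNode σ 1 k)) (deriv F u) :=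
    fun u => hu.tendsto_at u
  -- Boundedness of `F`: two partial sums that differ only in the term `k` are both within `1` of
  -- `deriv F`, so this term is at most `2` at every point; undoing the shift bounds `F` on all of
  -- `ℝ`.
  obtain ⟨s, hs1⟩ := eventually_atTop.1 (Metric.tendstoUniformly_iff.1 hu 1 one_pos)
  obtain ⟨k, hk⟩ := Infinite.exists_notMem_finset s
  have hck := rbCoeff_one_ne_zero hσ k
  refine bernsteinRep_of_hasSum_rb_one hp hσ hF (C := 2 / |rbCoeff σ 1 k|) (fun u => ?_) hs hGF
  have h1 := hs1 s le_rfl (u - rbNode σ 1 k)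
  have h2 := hs1 (insert k s) (Finset.subset_insert k s) (u - rbNode σ 1 k)
  rw [Finset.sum_insert hk, sub_add_cancel] at h2
  rw [le_div_iff₀ (abs_pos.2 hck), mul_comm]
  have e : |rbCoeff σ 1 k| * ‖F u‖ = ‖(rbCoeff σ 1 k : ℂ) * F u‖ := by
    rw [norm_mul, Complex.norm_real, Real.norm_eq_abs]
  rw [e]
  rw [dist_eq_norm] at h1 h2
  calc ‖(rbCoeff σ 1 k : ℂ) * F u‖ = ‖(deriv F (u - rbNode σ 1 k) -
        ∑ k_1 ∈ s, (rbCoeff σ 1 k_1 : ℂ) * F (u - rbNode σ 1 k + rbNode σ 1 k_1)) -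
        (deriv F (u - rbNode σ 1 k) - ((rbCoeff σ 1 k : ℂ) * F u +
        ∑ k_1 ∈ s, (rbCoeff σ 1 k_1 : ℂ) * F (u - rbNode σ 1 k + rbNode σ 1 k_1)))‖ := by
        congr 1; ring
    _ ≤ _ := norm_sub_le _ _
    _ ≤ 2 := by linarith

lemma BernsteinRep.summable_rb (h : BernsteinRep σ p G F) (r : ℕ) (u : ℝ) :
    Summable (fun k => ‖(rbCoeff σ r k : ℂ) * F (u + rbNode σ r k)‖) := by
  obtain ⟨C, hC⟩ := h.bounded
  refine Summable.of_nonneg_of_le (fun _ => norm_nonneg _) (fun k => ?_)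
    ((summable_rbCoeff σ r).mul_right C)
  rw [norm_mul, Complex.norm_real, Real.norm_eq_abs]
  gcongr
  simpa using hC 0 _

lemma BernsteinRep.tendstoUniformly_rb (hσ : 0 < σ) (h : BernsteinRep σ p G F) (r : ℕ) :
    TendstoUniformly (fun (s : Finset ℤ) (u : ℝ) =>
      ∑ k ∈ s, (rbCoeff σ r k : ℂ) * F (u + rbNode σ r k)) (iteratedDeriv r F) atTop := by
  obtain ⟨C, hC⟩ := h.bounded
  have := tendstoUniformly_tsum (f := fun k u => (rbCoeff σ r k : ℂ) * F (u + rbNode σ r k))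
    ((summable_rbCoeff σ r).mul_right C) (fun k u => by
      rw [norm_mul, Complex.norm_real, Real.norm_eq_abs]
      gcongr
      simpa using hC 0 _)
  have e : iteratedDeriv r F = fun u => ∑' k, (rbCoeff σ r k : ℂ) * F (u + rbNode σ r k) := by
    ext u
    exact (hasSum_rbCoeff h.smooth hσ hC r u).tsum_eq.symm
  rwa [e]

end

/-! ### Translation between `ℝ₊` and the logarithmic variable. -/

section

open scoped ENNReal Real ContDiff

/-- Shows that the separately defined `B_{m,0}` is `-sinc^(2m)(0)`, so that `k = 0` fits the general
pattern of the coefficients. -/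
lemma iteratedDeriv_sincN_zero (m : ℕ) :
    iteratedDeriv (2 * m) sincN 0 = (-1) ^ m * (π ^ (2 * m) / (2 * (m : ℝ) + 1)) := by
  have h : ((iteratedDeriv (2 * m) sincN 0 : ℝ) : ℂ) =
      (((-1) ^ m * (π ^ (2 * m) / (2 * (m : ℝ) + 1)) : ℝ) : ℂ) := by
    rw [iteratedDeriv_sincN]
    have e : ∀ v : ℝ, (2 * π * Complex.I * v) ^ (2 * m) *
        Complex.exp (2 * π * Complex.I * v * ((0 : ℝ) : ℂ)) =
        (((-1) ^ m * (2 * π) ^ (2 * m) * v ^ (2 * m) : ℝ) : ℂ) := by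
      intro v
      have hI : Complex.I ^ (2 * m) = (-1) ^ m := by rw [pow_mul, Complex.I_sq]
      push_cast
      rw [mul_zero, Complex.exp_zero, mul_one, mul_pow, mul_pow _ Complex.I, hI]
      ring
    simp only [e]
    rw [intervalIntegral.integral_ofReal, intervalIntegral.integral_const_mul, integral_pow]
    congr 1
    have hodd : Odd (2 * m + 1) := ⟨m, rfl⟩
    rw [hodd.neg_pow, pow_succ (1 / 2 : ℝ), one_div, inv_pow, mul_pow]
    have : (2 * (m : ℝ) + 1) ≠ 0 := by positivity
    push_cast
    field_simp
    ring
  exact_mod_cast h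

/-- The terms of the Riesz-Boas series in the logarithmic variable. -/
lemma rieszTerm_exp {r : ℕ} (hr : 1 ≤ r) (σ : ℝ) (f : ℝ → ℂ) (k : ℤ) (u : ℝ) :
    rieszTerm r σ f k (Real.exp u) =
      (rbCoeff σ r k : ℂ) * f (Real.exp (u + rbNode σ r k)) := by
  -- The sign inside the coefficient cancels the sign in the series.
  have hsq : ∀ y : ℝ, (-1 : ℝ) ^ (k + 1) * ((-1 : ℝ) ^ (k + 1) * y) = y := fun y => by
    rw [← mul_assoc, ← mul_zpow]; simp
  rw [rieszTerm]
  by_cases h : Odd r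
  · have e : 2 * ((r + 1) / 2) - 1 = r := by
      obtain ⟨m, rfl⟩ := h
      omega
    rw [if_pos h, termOdd, coeffA, e, hsq, ← Real.exp_add, rbCoeff, nodeCoeff, rbNode, node, if_pos h,
      neg_sub, add_comm u]
  · have hev := Nat.not_odd_iff_even.1 h
    have e : 2 * (r / 2) = r := by
      obtain ⟨m, rfl⟩ := hev
      omega
    rw [if_neg h, termEven, ← Real.exp_add, rbCoeff, nodeCoeff, rbNode, node, if_neg h, e,
      add_comm u, coeffB]
    have h1 : (-1 : ℝ) ^ (k + 1) * (if k = 0 then (-1 : ℝ) ^ (r / 2 + 1) *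
        (π ^ (2 * (r / 2)) / (2 * ((r / 2 : ℕ) : ℝ) + 1))
        else (-1 : ℝ) ^ (k + 1) * iteratedDeriv (2 * (r / 2)) sincN (-(k : ℝ))) =
        iteratedDeriv r sincN (-(k : ℝ)) := by
      split_ifs with hk
      · subst hk
        have := iteratedDeriv_sincN_zero (r / 2)
        rw [e] at this
        rw [Int.cast_zero, neg_zero, this, e, zero_add, zpow_one, pow_succ]
        ring
      · rw [hsq, e]
    rw [h1, mul_div_right_comm]

lemma contDiff_comp_exp {F : ℝ → ℂ} (hF : ContDiffOn ℝ ∞ F (Ioi 0)) :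
    ContDiff ℝ ∞ (fun u => F (Real.exp u)) := by
  rw [← contDiffOn_univ]
  exact hF.comp Real.contDiff_exp.contDiffOn fun u _ => Real.exp_pos u

lemma contDiffOn_comp_log {F : ℝ → ℂ} (hF : ContDiff ℝ ∞ F) :
    ContDiffOn ℝ ∞ (fun x => F (Real.log x)) (Ioi 0) :=
  hF.comp_contDiffOn (Real.contDiffOn_log.mono fun _ hx => (ne_of_gt hx : _ ≠ (0 : ℝ)))

/-- The operator `x d/dx` becomes differentiation in the logarithmic variable. -/
lemma contDiffOn_iterate_xddx {F : ℝ → ℂ} (hF : ContDiffOn ℝ ∞ F (Ioi 0)) (r : ℕ) :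
    ContDiffOn ℝ ∞ (xddx^[r] F) (Ioi 0) ∧
      ∀ u, xddx^[r] F (Real.exp u) = iteratedDeriv r (fun u => F (Real.exp u)) u := by
  induction r with
  | zero => exact ⟨hF, fun u => by simp⟩
  | succ r ih =>
    obtain ⟨h1, h2⟩ := ih
    rw [Function.iterate_succ_apply']
    refine ⟨?_, fun u => ?_⟩
    · have hd : ContDiffOn ℝ ∞ (deriv (xddx^[r] F)) (Ioi 0) :=
        h1.deriv_of_isOpen isOpen_Ioi (by simp)
      exact Complex.ofRealCLM.contDiff.contDiffOn.mul hd
    · have hdiff : DifferentiableAt ℝ (xddx^[r] F) (Real.exp u) :=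
        (h1.differentiableOn (by simp)).differentiableAt (Ioi_mem_nhds (Real.exp_pos u))
      have := (hdiff.hasDerivAt.scomp u (Real.hasDerivAt_exp u)).deriv
      have e : (xddx^[r] F) ∘ Real.exp = iteratedDeriv r (fun u => F (Real.exp u)) := by
        ext u; exact h2 u
      rw [e] at this
      rw [iteratedDeriv_succ, this, xddx, Complex.real_smul]

/-- Uniform convergence on `ℝ₊` is uniform convergence in the logarithmic variable. -/
lemma tendstoUniformlyOn_Ioi_iff {ι : Type*} {l : Filter ι} {S : ι → ℝ → ℂ} {T : ℝ → ℂ} :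
    TendstoUniformlyOn S T l (Ioi 0) ↔
      TendstoUniformly (fun i u => S i (Real.exp u)) (fun u => T (Real.exp u)) l := by
  rw [Metric.tendstoUniformlyOn_iff, Metric.tendstoUniformly_iff]
  refine forall₂_congr fun ε _ => eventually_congr (Eventually.of_forall fun i => ?_)
  constructor
  · exact fun h u => h _ (Real.exp_pos u)
  · intro h x hx
    simpa [Real.exp_log hx] using h (Real.log x)

lemma isRieszBoas_iff {p : ℝ≥0∞} (hp : 1 ≤ p) {r : ℕ} (hr : 1 ≤ r) {σ : ℝ} {f g : ℝ → ℂ} :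
    IsRieszBoas p r σ f g ↔ MemL p (fun u => g (Real.exp u)) ∧
      Tendsto (fun s : Finset ℤ => LNorm p (fun u => (∑ k ∈ s, (rbCoeff σ r k : ℂ) *
        f (Real.exp (u + rbNode σ r k))) - g (Real.exp u))) atTop (𝓝 0) := by
  rw [IsRieszBoas, memX_iff hp]
  simp only [xNorm_eq_lNorm hp, rieszTerm_exp hr]

lemma memBernstein_iff {p : ℝ≥0∞} (hp : 1 ≤ p) {σ : ℝ} {f : ℝ → ℂ} (hf : MemX p f) :
    MemBernstein σ p f ↔ MemLBernstein σ p (fun u => f (Real.exp u)) := by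
  rw [MemBernstein, MemLBernstein]
  simp only [hf, true_and, xNorm_eq_lNorm hp, isThetaPow_iff hp]
  refine forall_congr' fun k => ⟨fun ⟨g, hg⟩ => ⟨_, hg⟩, fun ⟨H, hH⟩ => ?_⟩
  exact ⟨fun x => H (Real.log x), by simpa only [Real.log_exp] using hH⟩

end

end MellinBernstein

end

/-! ### The equivalence theorem. -/

open MellinBernstein in
open scoped ENNReal ContDiff in
theorem mainTheorem3 (p : ℝ≥0∞) (hp : 1 ≤ p) (σ : ℝ) (hσ : 0 < σ) (f : ℝ → ℂ)
    (hf : MemX p f) :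
    (MemBernstein σ p f ↔
      ∀ r : ℕ, 1 ≤ r → ∃ g : ℝ → ℂ, IsThetaPow p r f g ∧ IsRieszBoas p r σ f g) ∧
    (MemBernstein σ p f ↔
      ∃ F : ℝ → ℂ, XEq p f F ∧ ContDiffOn ℝ ∞ F (Ioi 0) ∧
        ∀ r : ℕ, 1 ≤ r →
          (∀ x ∈ Ioi (0 : ℝ), Summable (fun k : ℤ => ‖rieszTerm r σ F k x‖)) ∧
          TendstoUniformlyOn (fun (s : Finset ℤ) (x : ℝ) => ∑ k ∈ s, rieszTerm r σ F k x)
            (xddx^[r] F) atTop (Ioi 0)) := by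
  have hG : MemL p (fun u => f (Real.exp u)) := (memX_iff hp).1 hf
  rw [memBernstein_iff hp hf]
  refine ⟨⟨fun h r hr => ?_, fun h => ?_⟩, fun h => ?_, ?_⟩
  · obtain ⟨F, hF⟩ := h.exists_rep hp hσ hG
    have hpow := hF.isGenPow hp hσ hG r
    refine ⟨fun x => iteratedDeriv r F (Real.log x), ?_, ?_⟩
    · rw [isThetaPow_iff hp]
      simpa only [Real.log_exp] using hpow
    · rw [isRieszBoas_iff hp hr]
      simp only [Real.log_exp]
      exact ⟨hpow.memL, hF.tendsto_rb hp hσ hG r⟩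
  · obtain ⟨F, hF⟩ := exists_rep_of_tendsto_rb hp hσ hG fun r hr => by
      obtain ⟨g, h1, h2⟩ := h r hr
      exact ⟨_, (isThetaPow_iff hp r).1 h1, ((isRieszBoas_iff hp hr).1 h2).2⟩
    exact hF.memLBernstein hp hσ hG
  · obtain ⟨F, hF⟩ := h.exists_rep hp hσ hG
    have hFs := contDiffOn_comp_log hF.smooth
    refine ⟨fun x => F (Real.log x), ?_, hFs, fun r hr => ⟨fun x hx => ?_, ?_⟩⟩
    · rw [xEq_iff hp hf.1 (hFs.continuousOn.aestronglyMeasurable measurableSet_Ioi)]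
      simpa only [Real.log_exp] using hF.lEq
    · have := hF.summable_rb r (Real.log x)
      rw [← Real.exp_log hx]
      simpa only [rieszTerm_exp hr, Real.log_exp] using this
    · rw [tendstoUniformlyOn_Ioi_iff]
      simp only [rieszTerm_exp hr, (contDiffOn_iterate_xddx hFs r).2, Real.log_exp]
      exact hF.tendstoUniformly_rb hσ r
  · rintro ⟨F, hfF, hFs, h⟩
    -- Uniform convergence at order one is all that this converse needs.
    have hu := (h 1 le_rfl).2
    rw [tendstoUniformlyOn_Ioi_iff] at hu
    simp only [rieszTerm_exp le_rfl, (contDiffOn_iterate_xddx hFs 1).2, iteratedDeriv_one] at hu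
    have hGF := (xEq_iff hp hf.1 (hFs.continuousOn.aestronglyMeasurable measurableSet_Ioi)).1 hfF
    exact (bernsteinRep_of_tendstoUniformly hp hσ
      ((contDiff_comp_exp hFs).of_le (by exact_mod_cast le_top)) hGF hu).memLBernstein hp hσ hG
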